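/- Let $\Delta=\{\zeta\in\mathbb C:|\zeta|<1\}$. For each integer $j\ge 1$ put $$Q_j=\{z\in\Delta:\ |z-\tfrac12+2^{-j}|>\tfrac12\},\qquad Q=\{z\in\Delta:\ |z-\tfrac12|>\tfrac12\},$$ $$D_j=\{(z,w)\in\mathbb C^2:\ z\in Q_j,\ w\in\Delta,\ w\ne z\},\qquad D=\{(z,w)\in\mathbb C^2:\ z\in Q,\ w\in\Delta,\ w\ne z\}.$$ For a bounded domain $G\subset\mathbb C^2$ let $\operatorname{Aut}(G)$ be the group of biholomorphic self-maps of $G$ with the compact-open topology. Then: 1. $D$ and all $D_j$ ($j\ge1$) are bounded pseudoconvex domains in $\mathbb C^2$. 2. $D_j\to D$ in $\mathcal H^2$, that is, the Hausdorff distance between $\partial D_j$ and $\partial D$ tends to $0$ as $j\to\infty$. 3. $\operatorname{Aut}(D_j)\cong S^1$ for each $j\ge1$, and $\operatorname{Aut}(D)\cong\mathbb R$, as topological groups. 4. Maximal compact subgroups disappear in the limit: for each $j\ge1$ the only maximal compact subgroup of $\operatorname{Aut}(D_j)$ is $\operatorname{Aut}(D_j)$ itself, while the only maximal compact subgroup of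 $\operatorname{Aut}(D)$ is the trivial group. -/

import Mathlib

open Set Filter Topology

/-- The complex Euclidean space `ℂⁿ`. -/
abbrev Cn (n : ℕ) : Type := EuclideanSpace ℂ (Fin n)

/-- A bounded domain in `ℂⁿ`: a nonempty, connected, open, bounded subset. -/
structure IsBoundedDomain {n : ℕ} (D : Set (Cn n)) : Prop where
  isOpen : IsOpen D
  isConnected : IsConnected D
  isBounded : Bornology.IsBounded D

/-- Convergence of domains in `ℋⁿ`: the Hausdorff distance between the boundaries tends to zero. -/
def ConvergesInH {n : ℕ} (D : ℕ → Set (Cn n)) (D₀ : Set (Cn n)) : Prop :=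
  Tendsto (fun j => Metric.hausdorffEDist (frontier (D j)) (frontier D₀)) atTop (𝓝 0)

/-- `u` is a continuous plurisubharmonic function on `D`: the sub-mean value inequality holds on
the boundary circle of every closed affine complex disc contained in `D`. -/
structure IsContinuousPSH {n : ℕ} (D : Set (Cn n)) (u : Cn n → ℝ) : Prop where
  continuousOn : ContinuousOn u D
  submean : ∀ a b : Cn n, (∀ ζ : ℂ, ‖ζ‖ ≤ 1 → a + ζ • b ∈ D) →
    u a ≤ Real.circleAverage (fun ζ : ℂ => u (a + ζ • b)) 0 1

/-- An open set `D` is pseudoconvex if it has a continuous plurisubharmonic exhaustion function. -/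
def IsPseudoconvex {n : ℕ} (D : Set (Cn n)) : Prop :=
  IsOpen D ∧ ∃ u : Cn n → ℝ, IsContinuousPSH D u ∧ ∀ c : ℝ, IsCompact {z | z ∈ D ∧ u z ≤ c}

/-- A self-map of `D` is holomorphic if it is the restriction to `D` of a function that is complex
differentiable on `D` (used for open `D`, where the values off `D` play no role). -/
def IsHolomorphicSelfMap {n : ℕ} {D : Set (Cn n)} (f : D → D) : Prop :=
  ∃ F : Cn n → Cn n, DifferentiableOn ℂ F D ∧ ∀ z : D, F z = f z

theorem IsHolomorphicSelfMap.continuous {n : ℕ} {D : Set (Cn n)} {f : D → D}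
    (hf : IsHolomorphicSelfMap f) : Continuous f := by
  obtain ⟨F, hF, h⟩ := hf
  refine Continuous.subtype_mk (f := fun z => (f z : Cn n)) ?_ (fun z => (f z).2)
  have h2 : (fun z => (f z : Cn n)) = D.domRestrict F := funext fun z => (h z).symm
  rw [h2]
  exact hF.continuousOn.domRestrict

theorem IsHolomorphicSelfMap.id {n : ℕ} {D : Set (Cn n)} :
    IsHolomorphicSelfMap (fun z : D => z) :=
  ⟨fun z => z, differentiableOn_id, fun _ => rfl⟩

theorem IsHolomorphicSelfMap.comp {n : ℕ} {D : Set (Cn n)} {f g : D → D}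
    (hf : IsHolomorphicSelfMap f) (hg : IsHolomorphicSelfMap g) :
    IsHolomorphicSelfMap (fun z => f (g z)) := by
  obtain ⟨F, hF, hFf⟩ := hf
  obtain ⟨G, hG, hGg⟩ := hg
  refine ⟨fun z => F (G z), hF.comp hG fun z hz => ?_, fun z => ?_⟩
  · have := hGg ⟨z, hz⟩
    simp only at this
    rw [this]
    exact (g ⟨z, hz⟩).2
  · change F (G z) = _
    rw [hGg z, hFf (g z)]

/-- The biholomorphic self-maps of `D`, as a subgroup of the group of bijections of `D`
(multiplication is composition). -/
noncomputable def biholSubgroup {n : ℕ} (D : Set (Cn n)) : Subgroup (Equiv.Perm D) where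
  carrier := {f | IsHolomorphicSelfMap f ∧ IsHolomorphicSelfMap f.symm}
  mul_mem' ha hb := ⟨ha.1.comp hb.1, hb.2.comp ha.2⟩
  one_mem' := ⟨IsHolomorphicSelfMap.id, IsHolomorphicSelfMap.id⟩
  inv_mem' h := ⟨h.2, h.1⟩

/-- The automorphism group `Aut(D)` of biholomorphic self-maps of `D`. -/
def HolAut {n : ℕ} (D : Set (Cn n)) : Type := biholSubgroup D

noncomputable instance {n : ℕ} (D : Set (Cn n)) : Group (HolAut D) :=
  inferInstanceAs (Group (biholSubgroup D))

/-- An automorphism as a continuous map. -/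
noncomputable def HolAut.toContinuousMap {n : ℕ} {D : Set (Cn n)} (f : HolAut D) : C(D, D) :=
  ⟨f.1, f.2.1.continuous⟩

/-- `Aut(D)` carries the compact-open topology (uniform convergence on compact subsets). -/
noncomputable instance {n : ℕ} (D : Set (Cn n)) : TopologicalSpace (HolAut D) :=
  TopologicalSpace.induced HolAut.toContinuousMap inferInstance

/-- A maximal compact subgroup: maximal, for inclusion, among the compact subgroups. -/
def IsMaximalCompactSubgroup {G : Type*} [Group G] [TopologicalSpace G] (K : Subgroup G) : Prop :=
  Maximal (fun H : Subgroup G => IsCompact (H : Set G)) K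

/-- `Q_j = {z ∈ Δ : |z - 1/2 + 2^{-j}| > 1/2}`. -/
def annulusQ (j : ℕ) : Set ℂ :=
  {z | z ∈ Metric.ball (0 : ℂ) 1 ∧ 1 / 2 < ‖z - 1 / 2 + (1 / 2) ^ j‖}

/-- The crescent `Q = {z ∈ Δ : |z - 1/2| > 1/2}`. -/
def crescentQ : Set ℂ :=
  {z | z ∈ Metric.ball (0 : ℂ) 1 ∧ 1 / 2 < ‖z - 1 / 2‖}

/-- `{(z, w) : z ∈ Q, w ∈ Δ, w ≠ z}` as a subset of `ℂ²`. -/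
def overBase (Q : Set ℂ) : Set (Cn 2) :=
  {p | p 0 ∈ Q ∧ p 1 ∈ Metric.ball (0 : ℂ) 1 ∧ p 1 ≠ p 0}

/-!
The domains are `overBase Q`, the complement of the diagonal in `Q × Δ`, where `Q` is the unit disc
`Δ` with a closed disc of radius `1 / 2` removed. The removed disc is compact in `Δ` for the members
of the sequence and internally tangent to the unit circle at `1` in the limit.

The heart of the matter is that every automorphism of `overBase Q` has the form
`(z, w) ↦ (ψ z, ψ w)` for an automorphism `ψ` of `Δ` which maps `Q` onto itself
(`IsRegularBase.exists_isDiscAutPreserving`). Being bounded, the automorphism extends across the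
diagonal (`exists_extension_across_diagonal`); since `Q` is the interior of its closure, the
extension is an automorphism of `Q × Δ` preserving the diagonal. Automorphisms of a product of
bounded planar domains are products up to an exchange of the factors
(`prod_or_swap_of_bijOn_prod`). An exchange would map the diagonal over `Q` onto the diagonal over
`Δ`, which is impossible, and a product map preserving the diagonal has the required form.

For the product theorem, let `(f, g)` be the components of the automorphism and let `w` tend to the
boundary of the second factor. Limits of `f (·, w)` and `g (·, w)` take values such that one of the
two lies on the boundary of its factor, so by the open mapping theorem one of the limits is
constant. Hence `(f (z, w) - f (z', w)) * (g (z, w) - g (z', w))` tends to zero, and it vanishes by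
the maximum principle. Taking limits along ultrafilters and working with differences makes
normal-family arguments and partial derivatives unnecessary.

It remains to find the automorphisms of `Δ` preserving `Q`. For a member of the sequence the removed
disc is a hyperbolic disc, and by the Schwarz lemma only the rotations about its hyperbolic centre
preserve it (`IsDiscAutPreserving.eq_rotationAbout`): the group is a circle, hence compact. In the
limit the removed disc is a horodisc, which the Cayley transform takes to the half-plane
`1 ≤ im ζ`; only the translations preserve it (`IsDiscAutPreserving.eq_parabolic`), so the group is
the real line, whose only compact subgroup is trivial.

For pseudoconvexity, the reciprocal of the minimum `δ` of `1 - ‖z‖`, `1 - ‖w‖`, `‖z - c‖ - 1 / 2` and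
`‖w - z‖` is an exhaustion function. It is plurisubharmonic because each of the four reciprocals is
at every point a maximum of moduli of holomorphic functions. Convergence of the boundaries follows
from their explicit description, since the centres of the removed discs converge.
-/

/-! ### Automorphisms of products of planar domains -/

/-- A holomorphic function bounded by `M` on a disc of radius `R` satisfies a Lipschitz estimate
at the centre, with constant `2 * M / R`. -/
theorem dist_le_of_norm_le_on_ball {f : ℂ → ℂ} {c z : ℂ} {R M : ℝ}
    (hd : DifferentiableOn ℂ f (Metric.ball c R)) (hM : ∀ x ∈ Metric.ball c R, ‖f x‖ ≤ M)
    (hz : z ∈ Metric.ball c R) : dist (f z) (f c) ≤ 2 * M / R * dist z c := by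
  have hR : 0 < R := Metric.nonempty_ball.mp ⟨z, hz⟩
  refine Complex.dist_le_div_mul_dist_of_mapsTo_ball hd (fun x hx => ?_) hz
  have h1 := hM x hx
  have h2 := hM c (Metric.mem_ball_self hR)
  rw [Metric.mem_closedBall, dist_eq_norm]
  linarith [norm_sub_le (f x) (f c)]

/-- A pointwise limit of uniformly bounded holomorphic functions is holomorphic: the functions are
locally equi-Lipschitz, so the convergence is locally uniform. -/
theorem differentiableOn_of_tendsto_of_norm_le {ι : Type*} {l : Filter ι} [l.NeBot]
    {F : ι → ℂ → ℂ} {f : ℂ → ℂ} {A : Set ℂ} {M : ℝ} (hA : IsOpen A)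
    (hF : ∀ᶠ i in l, DifferentiableOn ℂ (F i) A) (hM : ∀ᶠ i in l, ∀ z ∈ A, ‖F i z‖ ≤ M)
    (hlim : ∀ z ∈ A, Tendsto (fun i => F i z) l (𝓝 (f z))) : DifferentiableOn ℂ f A := by
  have key : TendstoLocallyUniformlyOn F f l A := by
    rw [Metric.tendstoLocallyUniformlyOn_iff]
    intro ε hε x hx
    obtain ⟨R, hR, hRA⟩ := Metric.isOpen_iff.1 hA x hx
    have hlip : ∀ᶠ i in l, ∀ y ∈ Metric.ball x R, dist (F i y) (F i x) ≤ 2 * M / R * dist y x := by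
      filter_upwards [hF, hM] with i h1 h2 y hy
      exact dist_le_of_norm_le_on_ball (h1.mono hRA) (fun z hz => h2 z (hRA hz)) hy
    have hlipf : ∀ y ∈ Metric.ball x R, dist (f y) (f x) ≤ 2 * M / R * dist y x := by
      intro y hy
      refine le_of_tendsto ((hlim y (hRA hy)).dist (hlim x hx)) ?_
      filter_upwards [hlip] with i hi using hi y hy
    have hcont : Tendsto (fun y => 2 * M / R * dist y x) (𝓝 x) (𝓝 0) := by
      have : Continuous fun y => 2 * M / R * dist y x := by fun_prop
      simpa using this.tendsto x
    refine ⟨Metric.ball x R ∩ {y | 2 * M / R * dist y x < ε / 3},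
      mem_nhdsWithin_of_mem_nhds (inter_mem (Metric.ball_mem_nhds x hR)
        (hcont.eventually (gt_mem_nhds (by positivity)))), ?_⟩
    filter_upwards [hlip, Metric.tendsto_nhds.1 (hlim x hx) (ε / 3) (by positivity)]
      with i hi hix y hy
    have h1 := hi y hy.1
    have h2 := hlipf y hy.1
    have h3 : 2 * M / R * dist y x < ε / 3 := hy.2
    have h4 := dist_triangle4 (f y) (f x) (F i x) (F i y)
    rw [dist_comm (f x), dist_comm (F i x) (F i y)] at h4
    linarith
  exact key.differentiableOn hF hA

/-- If two holomorphic functions on a connected open set are such that, at each point, the first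
lies on the boundary of an open set `C` or the second on the boundary of an open set `D`, then one
of them is constant, by the open mapping theorem. -/
theorem const_or_const_of_mem_frontier {A C D : Set ℂ} {f g : ℂ → ℂ} (hA : IsOpen A)
    (hA' : IsPreconnected A) (hC : IsOpen C) (hD : IsOpen D) (hf : DifferentiableOn ℂ f A)
    (hg : DifferentiableOn ℂ g A) (h : ∀ z ∈ A, f z ∈ frontier C ∨ g z ∈ frontier D) :
    (∃ c, ∀ z ∈ A, f z = c) ∨ (∃ c, ∀ z ∈ A, g z = c) := by
  have aux : ∀ {k : ℂ → ℂ} {E V : Set ℂ}, IsOpen E → DifferentiableOn ℂ k A →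
      (¬ ∃ c, ∀ z ∈ A, k z = c) → V ⊆ A → IsOpen V → V.Nonempty → ∃ z ∈ V, k z ∉ frontier E := by
    intro k E V hE hk hnc hVA hV hne
    by_contra! hcon
    have hopen := ((hk.analyticOnNhd hA).is_constant_or_isOpen hA').resolve_left hnc V hVA hV
    have hsub : k '' V ⊆ interior (frontier E) :=
      interior_maximal (image_subset_iff.2 hcon) hopen
    rw [← frontier_compl, interior_frontier hE.isClosed_compl] at hsub
    exact (hne.image k).not_subset_empty hsub
  by_contra! hcon
  obtain ⟨h1, h2⟩ := hcon
  rcases A.eq_empty_or_nonempty with rfl | hne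
  · simp at h1
  have hV : IsOpen (A ∩ f ⁻¹' (frontier C)ᶜ) :=
    hf.continuousOn.isOpen_inter_preimage hA isClosed_frontier.isOpen_compl
  obtain ⟨z₁, hz₁, hz₁'⟩ := aux hC hf (by push Not; exact h1) Subset.rfl hA hne
  obtain ⟨z₂, hz₂, hz₂'⟩ := aux hD hg (by push Not; exact h2) inter_subset_left hV
    ⟨z₁, hz₁, hz₁'⟩
  exact (h z₂ hz₂.1).elim hz₂.2 hz₂'

/-- Maximum principle: a holomorphic function on a connected open set which tends to zero along
every ultrafilter escaping to the boundary vanishes. -/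
theorem eq_zero_of_tendsto_zero_at_boundary {B : Set ℂ} {h : ℂ → ℂ} (hB : IsOpen B)
    (hB' : IsPreconnected B) (hh : DifferentiableOn ℂ h B)
    (ht : ∀ U : Ultrafilter ℂ, B ∈ U → (∀ b ∈ B, ¬ (U : Filter ℂ) ≤ 𝓝 b) →
      Tendsto h U (𝓝 0)) : ∀ w ∈ B, h w = 0 := by
  intro a ha
  by_contra hne
  have hcompact : IsCompact {w | w ∈ B ∧ ‖h a‖ ≤ ‖h w‖} := by
    rw [isCompact_iff_ultrafilter_le_nhds]
    intro U hU
    rw [le_principal_iff] at hU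
    have hBU : B ∈ U := mem_of_superset hU fun w hw => hw.1
    by_cases hb : ∃ b ∈ B, (U : Filter ℂ) ≤ 𝓝 b
    · obtain ⟨b, hb, hUb⟩ := hb
      refine ⟨b, ⟨hb, ?_⟩, hUb⟩
      have hc : Tendsto (fun w => ‖h w‖) U (𝓝 ‖h b‖) :=
        ((hh.continuousOn.continuousAt (hB.mem_nhds hb)).norm).tendsto.mono_left hUb
      exact ge_of_tendsto hc (mem_of_superset hU fun w hw => hw.2)
    · push Not at hb
      have h0 := (ht U hBU hb).norm
      rw [norm_zero] at h0
      have := ge_of_tendsto h0 (mem_of_superset hU fun w hw => hw.2)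
      exact absurd (norm_le_zero_iff.1 this) hne
  have hcont : ContinuousOn (fun w => ‖h w‖) {w | w ∈ B ∧ ‖h a‖ ≤ ‖h w‖} :=
    (hh.continuousOn.norm).mono fun w hw => hw.1
  obtain ⟨b, hb, hmax⟩ := hcompact.exists_isMaxOn ⟨a, ha, le_rfl⟩ hcont
  have hmaxB : IsMaxOn (norm ∘ h) B b := by
    intro w hw
    by_cases hwa : ‖h a‖ ≤ ‖h w‖
    · exact hmax ⟨hw, hwa⟩
    · exact (not_le.1 hwa).le.trans hb.2
  have hconst := Complex.norm_eqOn_of_isPreconnected_of_isMaxOn hB' hB hh hb.1 hmaxB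
  have hBeq : {w | w ∈ B ∧ ‖h a‖ ≤ ‖h w‖} = B := by
    ext w
    refine ⟨fun hw => hw.1, fun hw => ⟨hw, ?_⟩⟩
    have h1 : ‖h w‖ = ‖h b‖ := hconst hw
    rw [h1]
    exact hb.2
  rw [hBeq] at hcompact
  have huniv := IsClopen.eq_univ ⟨hcompact.isClosed, hB⟩ ⟨a, ha⟩
  exact noncompact_univ ℂ (huniv ▸ hcompact)

/-- The ring of holomorphic functions on a connected open set has no zero divisors. -/
theorem eqOn_zero_or_eqOn_zero_of_mul_eq_zero {B : Set ℂ} {h k : ℂ → ℂ} (hB : IsOpen B)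
    (hB' : IsPreconnected B) (hh : DifferentiableOn ℂ h B) (hk : DifferentiableOn ℂ k B)
    (hmul : ∀ w ∈ B, h w * k w = 0) : (∀ w ∈ B, h w = 0) ∨ (∀ w ∈ B, k w = 0) := by
  by_contra! hcon
  obtain ⟨⟨w, hw, hne⟩, ⟨v, hv, hne'⟩⟩ := hcon
  have hev : k =ᶠ[𝓝 w] 0 := by
    filter_upwards [(hh.continuousOn.continuousAt (hB.mem_nhds hw)).eventually_ne hne,
      hB.mem_nhds hw] with x hx hxB
    exact (mul_eq_zero.1 (hmul x hxB)).resolve_left hx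
  exact hne' ((hk.analyticOnNhd hB).eqOn_zero_of_preconnected_of_eventuallyEq_zero hB' hw hev hv)

/-- One half of the product theorem: if `F = (f, g)` is injective and separately holomorphic on a
product `A ×ˢ B` of planar domains, with a continuous left inverse defined on a bounded product
`C ×ˢ D`, then `f` or `g` does not depend on the first variable. As `w` tends to the boundary of
`B`, limits of the pairs `(f (·, w), g (·, w))` take values in the boundary of `C ×ˢ D`, so that
one of the two limit functions is constant; therefore
`(f (z, w) - f (z', w)) * (g (z, w) - g (z', w))` tends to zero and vanishes identically. -/
theorem fst_or_snd_indep_of_left {A B C D : Set ℂ} {F G : ℂ × ℂ → ℂ × ℂ}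
    (hA : IsOpen A) (hA' : IsPreconnected A) (hB : IsOpen B) (hB' : IsPreconnected B)
    (hC : IsOpen C) (hC' : Bornology.IsBounded C) (hD : IsOpen D) (hD' : Bornology.IsBounded D)
    (hF₁ : ∀ w ∈ B, DifferentiableOn ℂ (fun z => F (z, w)) A)
    (hF₂ : ∀ z ∈ A, DifferentiableOn ℂ (fun w => F (z, w)) B)
    (hF : MapsTo F (A ×ˢ B) (C ×ˢ D)) (hG : MapsTo G (C ×ˢ D) (A ×ˢ B))
    (hGc : ContinuousOn G (C ×ˢ D)) (hGF : LeftInvOn G F (A ×ˢ B)) :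
    (∀ z ∈ A, ∀ z' ∈ A, ∀ w ∈ B, (F (z, w)).1 = (F (z', w)).1) ∨
      (∀ z ∈ A, ∀ z' ∈ A, ∀ w ∈ B, (F (z, w)).2 = (F (z', w)).2) := by
  have hinj : ∀ z ∈ A, ∀ z' ∈ A, ∀ w ∈ B, (F (z, w)).1 = (F (z', w)).1 →
      (F (z, w)).2 = (F (z', w)).2 → z = z' := by
    intro z hz z' hz' w hw h1 h2
    have := hGF.injOn (mk_mem_prod hz hw) (mk_mem_prod hz' hw) (Prod.ext h1 h2)
    exact (Prod.ext_iff.1 this).1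
  have hmul : ∀ z ∈ A, ∀ z' ∈ A, ∀ w ∈ B,
      ((F (z, w)).1 - (F (z', w)).1) * ((F (z, w)).2 - (F (z', w)).2) = 0 := by
    intro z hz z' hz'
    refine eq_zero_of_tendsto_zero_at_boundary hB hB'
      (((hF₂ z hz).fst.sub (hF₂ z' hz').fst).mul ((hF₂ z hz).snd.sub (hF₂ z' hz').snd)) ?_
    intro U hBU hesc
    have hlim : ∀ x, ∃ y : ℂ × ℂ, x ∈ A →
        y ∈ closure (C ×ˢ D) ∧ Tendsto (fun w => F (x, w)) U (𝓝 y) := by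
      intro x
      by_cases hx : x ∈ A
      · have hle : (U.map fun w => F (x, w) : Filter (ℂ × ℂ)) ≤ 𝓟 (closure (C ×ˢ D)) := by
          rw [le_principal_iff]
          have hsub : B ⊆ (fun w => F (x, w)) ⁻¹' closure (C ×ˢ D) := fun w hw =>
            subset_closure (hF (mk_mem_prod hx hw))
          exact Ultrafilter.mem_map.2 (mem_of_superset hBU hsub)
        obtain ⟨y, hy, hy'⟩ :=
          (hC'.prod hD').isCompact_closure.ultrafilter_le_nhds (U.map fun w => F (x, w)) hle
        exact ⟨y, fun _ => ⟨hy, hy'⟩⟩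
      · exact ⟨0, fun h => absurd h hx⟩
    choose L hL using hlim
    have hfr : ∀ x ∈ A, (L x).1 ∈ frontier C ∨ (L x).2 ∈ frontier D := by
      intro x hx
      obtain ⟨hcl, htend⟩ := hL x hx
      rw [closure_prod_eq] at hcl
      by_contra! hcon
      rw [hC.frontier_eq, hD.frontier_eq] at hcon
      have h1 : (L x).1 ∈ C := by_contra fun h => hcon.1 ⟨hcl.1, h⟩
      have h2 : (L x).2 ∈ D := by_contra fun h => hcon.2 ⟨hcl.2, h⟩
      have hmem : L x ∈ C ×ˢ D := ⟨h1, h2⟩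
      have ht : Tendsto (fun w => (G (F (x, w))).2) U (𝓝 (G (L x)).2) :=
        (((hGc.continuousAt ((hC.prod hD).mem_nhds hmem)).tendsto.comp htend).snd_nhds)
      refine hesc _ (hG hmem).2 ?_
      have hid : Tendsto id (U : Filter ℂ) (𝓝 (G (L x)).2) := by
        refine ht.congr' ?_
        filter_upwards [hBU] with w hw
        rw [hGF (mk_mem_prod hx hw)]
        rfl
      exact hid
    obtain ⟨M₁, hM₁⟩ := hC'.exists_norm_le
    obtain ⟨M₂, hM₂⟩ := hD'.exists_norm_le
    have hL₁ : DifferentiableOn ℂ (fun x => (L x).1) A :=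
      differentiableOn_of_tendsto_of_norm_le (l := U) (F := fun w x => (F (x, w)).1) (M := M₁) hA
        (mem_of_superset hBU fun w hw => (hF₁ w hw).fst)
        (mem_of_superset hBU fun w hw x hx => hM₁ _ (hF (mk_mem_prod hx hw)).1)
        (fun x hx => (hL x hx).2.fst_nhds)
    have hL₂ : DifferentiableOn ℂ (fun x => (L x).2) A :=
      differentiableOn_of_tendsto_of_norm_le (l := U) (F := fun w x => (F (x, w)).2) (M := M₂) hA
        (mem_of_superset hBU fun w hw => (hF₁ w hw).snd)
        (mem_of_superset hBU fun w hw x hx => hM₂ _ (hF (mk_mem_prod hx hw)).2)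
        (fun x hx => (hL x hx).2.snd_nhds)
    have hprod : Tendsto
        (fun w => ((F (z, w)).1 - (F (z', w)).1) * ((F (z, w)).2 - (F (z', w)).2)) U
        (𝓝 (((L z).1 - (L z').1) * ((L z).2 - (L z').2))) :=
      ((hL z hz).2.fst_nhds.sub (hL z' hz').2.fst_nhds).mul
        ((hL z hz).2.snd_nhds.sub (hL z' hz').2.snd_nhds)
    have hzero : ((L z).1 - (L z').1) * ((L z).2 - (L z').2) = 0 := by
      rcases const_or_const_of_mem_frontier hA hA' hC hD hL₁ hL₂ hfr with ⟨c, hc⟩ | ⟨c, hc⟩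
      · rw [hc z hz, hc z' hz', sub_self, zero_mul]
      · rw [hc z hz, hc z' hz', sub_self, mul_zero]
    rwa [hzero] at hprod
  by_cases hsub : A.Subsingleton
  · left
    intro z hz z' hz' w _
    rw [hsub hz hz']
  obtain ⟨a, ha, a', ha', hne⟩ := not_subsingleton_iff.1 hsub
  -- For each `w`, one component of `F (·, w)` is constant on `A`.
  have hconst : ∀ w ∈ B, (∀ z ∈ A, (F (z, w)).1 - (F (a, w)).1 = 0) ∨
      (∀ z ∈ A, (F (z, w)).2 - (F (a, w)).2 = 0) := fun w hw =>
    eqOn_zero_or_eqOn_zero_of_mul_eq_zero hA hA' ((hF₁ w hw).fst.sub_const _)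
      ((hF₁ w hw).snd.sub_const _) fun z hz => hmul z hz a ha w hw
  rcases eqOn_zero_or_eqOn_zero_of_mul_eq_zero hB hB' ((hF₂ a' ha').fst.sub (hF₂ a ha).fst)
    ((hF₂ a' ha').snd.sub (hF₂ a ha).snd) (fun w hw => hmul a' ha' a ha w hw) with h | h
  · left
    intro z hz z' hz' w hw
    rcases hconst w hw with h' | h'
    · rw [sub_eq_zero.1 (h' z hz), sub_eq_zero.1 (h' z' hz')]
    · exact absurd (hinj a' ha' a ha w hw (sub_eq_zero.1 (h w hw))
        (sub_eq_zero.1 (h' a' ha'))).symm hne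
  · right
    intro z hz z' hz' w hw
    rcases hconst w hw with h' | h'
    · exact absurd (hinj a' ha' a ha w hw (sub_eq_zero.1 (h' a' ha'))
        (sub_eq_zero.1 (h w hw))).symm hne
    · rw [sub_eq_zero.1 (h' z hz), sub_eq_zero.1 (h' z' hz')]

/-- A separately holomorphic bijection between products of bounded planar domains, with continuous
inverse, is a product map up to exchanging the factors. -/
theorem prod_or_swap_of_bijOn_prod {A B C D : Set ℂ} {F G : ℂ × ℂ → ℂ × ℂ}
    (hA : IsOpen A) (hA' : IsPreconnected A) (hB : IsOpen B) (hB' : IsPreconnected B)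
    (hC : IsOpen C) (hC' : Bornology.IsBounded C) (hCn : C.Nontrivial)
    (hD : IsOpen D) (hD' : Bornology.IsBounded D) (hDn : D.Nontrivial)
    (hF₁ : ∀ w ∈ B, DifferentiableOn ℂ (fun z => F (z, w)) A)
    (hF₂ : ∀ z ∈ A, DifferentiableOn ℂ (fun w => F (z, w)) B)
    (hF : MapsTo F (A ×ˢ B) (C ×ˢ D)) (hG : MapsTo G (C ×ˢ D) (A ×ˢ B))
    (hGc : ContinuousOn G (C ×ˢ D)) (hGF : LeftInvOn G F (A ×ˢ B))
    (hFG : RightInvOn G F (C ×ˢ D)) :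
    ((∀ z ∈ A, ∀ w ∈ B, ∀ w' ∈ B, (F (z, w)).1 = (F (z, w')).1) ∧
      (∀ z ∈ A, ∀ z' ∈ A, ∀ w ∈ B, (F (z, w)).2 = (F (z', w)).2)) ∨
    ((∀ z ∈ A, ∀ z' ∈ A, ∀ w ∈ B, (F (z, w)).1 = (F (z', w)).1) ∧
      (∀ z ∈ A, ∀ w ∈ B, ∀ w' ∈ B, (F (z, w)).2 = (F (z, w')).2)) := by
  have h1 := fst_or_snd_indep_of_left hA hA' hB hB' hC hC' hD hD' hF₁ hF₂ hF hG hGc hGF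
  have h2 := fst_or_snd_indep_of_left (F := fun p => F p.swap) (G := fun p => (G p).swap)
    hB hB' hA hA' hC hC' hD hD' hF₂ hF₁ (fun p hp => hF ⟨hp.2, hp.1⟩)
    (fun p hp => ⟨(hG hp).2, (hG hp).1⟩) (continuous_swap.comp_continuousOn hGc)
    (fun p hp => by
      change (G (F p.swap)).swap = p
      rw [hGF ⟨hp.2, hp.1⟩, Prod.swap_swap])
  have hsurj : ∀ c ∈ C, ∀ d ∈ D, ∃ z ∈ A, ∃ w ∈ B, F (z, w) = (c, d) := fun c hc d hd =>
    ⟨_, (hG (mk_mem_prod hc hd)).1, _, (hG (mk_mem_prod hc hd)).2, hFG (mk_mem_prod hc hd)⟩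
  obtain ⟨c, hc, c', hc', hcc⟩ := hCn
  obtain ⟨d, hd, d', hd', hdd⟩ := hDn
  rcases h1 with h1 | h1 <;> rcases h2 with h2 | h2
  · obtain ⟨z, hz, w, hw, e⟩ := hsurj c hc d hd
    obtain ⟨z', hz', w', hw', e'⟩ := hsurj c' hc' d hd
    have := (h1 z hz z' hz' w hw).trans (h2 w hw w' hw' z' hz')
    rw [Prod.swap_prod_mk, e, e'] at this
    exact absurd this hcc
  · exact Or.inr ⟨h1, fun z hz w hw w' hw' => h2 w hw w' hw' z hz⟩
  · exact Or.inl ⟨fun z hz w hw w' hw' => h2 w hw w' hw' z hz, h1⟩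
  · obtain ⟨z, hz, w, hw, e⟩ := hsurj c hc d hd
    obtain ⟨z', hz', w', hw', e'⟩ := hsurj c hc d' hd'
    have := (h1 z hz z' hz' w hw).trans (h2 w hw w' hw' z' hz')
    rw [Prod.swap_prod_mk, e, e'] at this
    exact absurd this hdd

/-! ### Extension across the diagonal -/

/-- Riemann's theorem on removable singularities, with the bound for the extension. The exceptional
point need not belong to the open set. -/
theorem exists_differentiableOn_extension {U : Set ℂ} {c : ℂ} {f : ℂ → ℂ} {M : ℝ} (hU : IsOpen U)
    (hf : DifferentiableOn ℂ f (U \ {c})) (hM : ∀ z ∈ U \ {c}, ‖f z‖ ≤ M) :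
    ∃ k : ℂ → ℂ, DifferentiableOn ℂ k U ∧ EqOn k f (U \ {c}) ∧ ∀ z ∈ U, ‖k z‖ ≤ M := by
  by_cases hc : c ∈ U
  · have hd := Complex.differentiableOn_update_limUnder_of_bddAbove (hU.mem_nhds hc) hf
      ⟨M, by rintro _ ⟨z, hz, rfl⟩; exact hM z hz⟩
    set k := Function.update f c (limUnder (𝓝[≠] c) f)
    have heq : EqOn k f (U \ {c}) := fun z hz => Function.update_of_ne hz.2 _ _
    refine ⟨k, hd, heq, fun z hz => ?_⟩
    rcases eq_or_ne z c with rfl | hne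
    · have ht : Tendsto (fun y => ‖k y‖) (𝓝[≠] z) (𝓝 ‖k z‖) :=
        ((hd.continuousOn.continuousAt (hU.mem_nhds hz)).norm).tendsto.mono_left inf_le_left
      refine le_of_tendsto ht ?_
      filter_upwards [self_mem_nhdsWithin, mem_nhdsWithin_of_mem_nhds (hU.mem_nhds hz)] with y h1 h2
      rw [heq ⟨h2, h1⟩]
      exact hM y ⟨h2, h1⟩
    · rw [heq ⟨hz, hne⟩]
      exact hM z ⟨hz, hne⟩
  · rw [sdiff_singleton_eq_self hc] at hf hM
    exact ⟨f, hf, fun _ _ => rfl, hM⟩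

/-- A bounded separately holomorphic function on the complement of the diagonal in a product of
open sets extends to a continuous, separately holomorphic function on the product. The extension
in the second variable, for each value of the first, is locally Lipschitz in either variable. -/
theorem exists_extension_across_diagonal {A B : Set ℂ} {f : ℂ × ℂ → ℂ} {M : ℝ} (hA : IsOpen A)
    (hB : IsOpen B) (hf₁ : ∀ w ∈ B, DifferentiableOn ℂ (fun z => f (z, w)) (A \ {w}))
    (hf₂ : ∀ z ∈ A, DifferentiableOn ℂ (fun w => f (z, w)) (B \ {z}))
    (hM : ∀ z ∈ A, ∀ w ∈ B, w ≠ z → ‖f (z, w)‖ ≤ M) :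
    ∃ g : ℂ × ℂ → ℂ, ContinuousOn g (A ×ˢ B) ∧
      (∀ z ∈ A, ∀ w ∈ B, w ≠ z → g (z, w) = f (z, w)) ∧
      (∀ w ∈ B, DifferentiableOn ℂ (fun z => g (z, w)) A) ∧
      (∀ z ∈ A, DifferentiableOn ℂ (fun w => g (z, w)) B) := by
  have hext : ∀ z, ∃ k : ℂ → ℂ, z ∈ A → DifferentiableOn ℂ k B ∧
      EqOn k (fun w => f (z, w)) (B \ {z}) ∧ ∀ w ∈ B, ‖k w‖ ≤ M := by
    intro z
    by_cases hz : z ∈ A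
    · obtain ⟨k, hk⟩ := exists_differentiableOn_extension hB (hf₂ z hz)
        fun w hw => hM z hz w hw.1 hw.2
      exact ⟨k, fun _ => hk⟩
    · exact ⟨0, fun h => absurd h hz⟩
  choose k hk using hext
  have hlip₂ : ∀ z ∈ A, ∀ w₀ : ℂ, ∀ R : ℝ, Metric.ball w₀ R ⊆ B → ∀ w ∈ Metric.ball w₀ R,
      dist (k z w) (k z w₀) ≤ 2 * M / R * dist w w₀ := fun z hz w₀ R hR w hw =>
    dist_le_of_norm_le_on_ball ((hk z hz).1.mono hR) (fun x hx => (hk z hz).2.2 x (hR hx)) hw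
  have hlip₁' : ∀ w ∈ B, ∀ z₀ : ℂ, ∀ R : ℝ, Metric.ball z₀ R ⊆ A → ∀ z ∈ Metric.ball z₀ R,
      w ≠ z → w ≠ z₀ → dist (f (z, w)) (f (z₀, w)) ≤ 2 * M / R * dist z z₀ := by
    intro w hw z₀ R hR z hz hne hne₀
    obtain ⟨h, h1, h2, h3⟩ := exists_differentiableOn_extension hA (hf₁ w hw)
      fun z hz => hM z hz.1 w hw (Ne.symm hz.2)
    have hR0 : 0 < R := Metric.nonempty_ball.mp ⟨z, hz⟩
    have e1 : h z = f (z, w) := h2 ⟨hR hz, Ne.symm hne⟩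
    have e2 : h z₀ = f (z₀, w) := h2 ⟨hR (Metric.mem_ball_self hR0), Ne.symm hne₀⟩
    rw [← e1, ← e2]
    exact dist_le_of_norm_le_on_ball (h1.mono hR) (fun x hx => h3 x (hR hx)) hz
  have hlip₁ : ∀ w ∈ B, ∀ z₀ : ℂ, ∀ R : ℝ, Metric.ball z₀ R ⊆ A → ∀ z ∈ Metric.ball z₀ R,
      dist (k z w) (k z₀ w) ≤ 2 * M / R * dist z z₀ := by
    intro w hw z₀ R hR z hz
    have hz₀ : z₀ ∈ A := hR (Metric.mem_ball_self (Metric.nonempty_ball.mp ⟨z, hz⟩))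
    have hcont : ∀ x ∈ A, Tendsto (fun y => k x y) (𝓝[≠] w) (𝓝 (k x w)) := fun x hx =>
      ((hk x hx).1.continuousOn.continuousAt (hB.mem_nhds hw)).tendsto.mono_left inf_le_left
    have hne : ∀ x : ℂ, ∀ᶠ y in 𝓝[≠] w, y ≠ x := by
      intro x
      rcases eq_or_ne w x with rfl | h
      · exact self_mem_nhdsWithin
      · exact mem_nhdsWithin_of_mem_nhds (isOpen_ne.mem_nhds h)
    refine le_of_tendsto ((hcont z (hR hz)).dist (hcont z₀ hz₀)) ?_
    filter_upwards [hne z, hne z₀, mem_nhdsWithin_of_mem_nhds (hB.mem_nhds hw)] with y h1 h2 h3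
    rw [(hk z (hR hz)).2.1 ⟨h3, h1⟩, (hk z₀ hz₀).2.1 ⟨h3, h2⟩]
    exact hlip₁' y h3 z₀ R hR z hz h1 h2
  have hcont : ContinuousOn (fun p : ℂ × ℂ => k p.1 p.2) (A ×ˢ B) := by
    rintro ⟨z₀, w₀⟩ ⟨hz₀, hw₀⟩
    obtain ⟨R, hR, hRA⟩ := Metric.isOpen_iff.1 hA z₀ hz₀
    obtain ⟨S, hS, hSB⟩ := Metric.isOpen_iff.1 hB w₀ hw₀
    refine ContinuousAt.continuousWithinAt ?_
    rw [ContinuousAt, tendsto_iff_dist_tendsto_zero]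
    have hbound : Tendsto (fun p : ℂ × ℂ => 2 * M / S * dist p.2 w₀ + 2 * M / R * dist p.1 z₀)
        (𝓝 (z₀, w₀)) (𝓝 0) := by
      have : Continuous fun p : ℂ × ℂ => 2 * M / S * dist p.2 w₀ + 2 * M / R * dist p.1 z₀ := by
        fun_prop
      simpa using this.tendsto (z₀, w₀)
    refine squeeze_zero' (Eventually.of_forall fun p => dist_nonneg) ?_ hbound
    filter_upwards [prod_mem_nhds (Metric.ball_mem_nhds z₀ hR) (Metric.ball_mem_nhds w₀ hS)]
      with p hp
    refine (dist_triangle _ (k p.1 w₀) _).trans (add_le_add ?_ ?_)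
    · exact hlip₂ p.1 (hRA hp.1) w₀ S hSB p.2 hp.2
    · exact hlip₁ w₀ hw₀ z₀ R hRA p.1 hp.1
  refine ⟨fun p => k p.1 p.2, hcont, fun z hz w hw hne => (hk z hz).2.1 ⟨hw, hne⟩, ?_,
    fun z hz => (hk z hz).1⟩
  intro w hw
  have hoff : DifferentiableOn ℂ (fun z => k z w) (A \ {w}) :=
    (hf₁ w hw).congr fun z hz => (hk z hz.1).2.1 ⟨hw, Ne.symm hz.2⟩
  by_cases hwA : w ∈ A
  · refine (Complex.differentiableOn_compl_singleton_and_continuousAt_iff (hA.mem_nhds hwA)).1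
      ⟨hoff, ?_⟩
    have h1 : ContinuousAt (fun p : ℂ × ℂ => k p.1 p.2) (w, w) :=
      hcont.continuousAt ((hA.prod hB).mem_nhds ⟨hwA, hw⟩)
    exact h1.comp (f := fun z : ℂ => (z, w)) (by fun_prop)
  · rwa [sdiff_singleton_eq_self hwA] at hoff

/-- The same for maps into `ℂ × ℂ`. -/
theorem exists_extension_across_diagonal_prod {A B : Set ℂ} {F : ℂ × ℂ → ℂ × ℂ} {M : ℝ}
    (hA : IsOpen A) (hB : IsOpen B)
    (hF₁ : ∀ w ∈ B, DifferentiableOn ℂ (fun z => F (z, w)) (A \ {w}))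
    (hF₂ : ∀ z ∈ A, DifferentiableOn ℂ (fun w => F (z, w)) (B \ {z}))
    (hM : ∀ z ∈ A, ∀ w ∈ B, w ≠ z → ‖F (z, w)‖ ≤ M) :
    ∃ G : ℂ × ℂ → ℂ × ℂ, ContinuousOn G (A ×ˢ B) ∧
      (∀ z ∈ A, ∀ w ∈ B, w ≠ z → G (z, w) = F (z, w)) ∧
      (∀ w ∈ B, DifferentiableOn ℂ (fun z => G (z, w)) A) ∧
      (∀ z ∈ A, DifferentiableOn ℂ (fun w => G (z, w)) B) := by
  obtain ⟨g₁, c₁, e₁, a₁, b₁⟩ := exists_extension_across_diagonal (f := fun p => (F p).1) hA hB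
    (fun w hw => (hF₁ w hw).fst) (fun z hz => (hF₂ z hz).fst)
    (fun z hz w hw h => (norm_fst_le _).trans (hM z hz w hw h))
  obtain ⟨g₂, c₂, e₂, a₂, b₂⟩ := exists_extension_across_diagonal (f := fun p => (F p).2) hA hB
    (fun w hw => (hF₁ w hw).snd) (fun z hz => (hF₂ z hz).snd)
    (fun z hz w hw h => (norm_snd_le _).trans (hM z hz w hw h))
  exact ⟨fun p => (g₁ p, g₂ p), c₁.prodMk c₂,
    fun z hz w hw h => Prod.ext (e₁ z hz w hw h) (e₂ z hz w hw h),
    fun w hw => (a₁ w hw).prodMk (a₂ w hw), fun z hz => (b₁ z hz).prodMk (b₂ z hz)⟩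

/-! ### Automorphisms of the complement of the diagonal -/

/-- `ψ` restricts to an automorphism of the unit disc, with inverse `ψ'`, which maps the subset `Q`
of the disc onto itself. The values of `ψ` and `ψ'` off the disc play no role. -/
structure IsDiscAutPreserving (Q : Set ℂ) (ψ ψ' : ℂ → ℂ) : Prop where
  differentiableOn : DifferentiableOn ℂ ψ (Metric.ball 0 1)
  differentiableOn_inv : DifferentiableOn ℂ ψ' (Metric.ball 0 1)
  mapsTo : MapsTo ψ (Metric.ball 0 1) (Metric.ball 0 1)
  mapsTo_inv : MapsTo ψ' (Metric.ball 0 1) (Metric.ball 0 1)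
  leftInv : LeftInvOn ψ' ψ (Metric.ball 0 1)
  rightInv : LeftInvOn ψ ψ' (Metric.ball 0 1)
  mapsTo_base : MapsTo ψ Q Q
  mapsTo_base_inv : MapsTo ψ' Q Q

/-- An open connected set `Q`, strictly contained in the unit disc, which is the interior of its
closure. -/
structure IsRegularBase (Q : Set ℂ) : Prop where
  isOpen : IsOpen Q
  isConnected : IsConnected Q
  subset_ball : Q ⊆ Metric.ball 0 1
  exists_notMem : ∃ b ∈ Metric.ball (0 : ℂ) 1, b ∉ Q
  interior_closure_subset : interior (closure Q) ⊆ Q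

/-- If a holomorphic function on a connected open set maps the complement of a point into `Q`, then
it maps the point into the interior of the closure of `Q`, by the open mapping theorem. -/
theorem mem_of_interior_closure_subset {U Q : Set ℂ} {f : ℂ → ℂ} {c : ℂ} (hU : IsOpen U)
    (hU' : IsPreconnected U) (hc : c ∈ U) (hf : DifferentiableOn ℂ f U)
    (hQ : interior (closure Q) ⊆ Q) (hmaps : ∀ z ∈ U, z ≠ c → f z ∈ Q) : f c ∈ Q := by
  have hev : ∀ᶠ z in 𝓝[≠] c, z ∈ U ∧ z ≠ c :=
    inter_mem (mem_nhdsWithin_of_mem_nhds (hU.mem_nhds hc)) self_mem_nhdsWithin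
  rcases (hf.analyticOnNhd hU).is_constant_or_isOpen hU' with ⟨v, hv⟩ | hopen
  · obtain ⟨z, hz, hne⟩ := hev.exists
    rw [hv c hc, ← hv z hz]
    exact hmaps z hz hne
  · apply hQ
    have hcl : f '' U ⊆ closure Q := by
      rintro _ ⟨z, hz, rfl⟩
      rcases eq_or_ne z c with rfl | hne
      · have ht : Tendsto f (𝓝[≠] z) (𝓝 (f z)) :=
          (hf.continuousOn.continuousAt (hU.mem_nhds hc)).tendsto.mono_left inf_le_left
        exact mem_closure_of_tendsto ht (hev.mono fun y hy => hmaps y hy.1 hy.2)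
      · exact subset_closure (hmaps z hz hne)
    exact interior_maximal hcl (hopen U Subset.rfl hU) (mem_image_of_mem f hc)

/-- The complement of the diagonal in `Q × Δ`, as a subset of `ℂ × ℂ`. -/
def offDiagonalOver (Q : Set ℂ) : Set (ℂ × ℂ) :=
  {p | p.1 ∈ Q ∧ p.2 ∈ Metric.ball (0 : ℂ) 1 ∧ p.2 ≠ p.1}

/-- A self-map of `offDiagonalOver Q` which is holomorphic in each variable extends to a map of
`Q × Δ` into itself which is continuous and holomorphic in each variable. -/
theorem IsRegularBase.exists_extension {Q : Set ℂ} (hQ : IsRegularBase Q) {F : ℂ × ℂ → ℂ × ℂ}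
    (hF : MapsTo F (offDiagonalOver Q) (offDiagonalOver Q))
    (hF₁ : ∀ w ∈ Metric.ball (0 : ℂ) 1, DifferentiableOn ℂ (fun z => F (z, w)) (Q \ {w}))
    (hF₂ : ∀ z ∈ Q, DifferentiableOn ℂ (fun w => F (z, w)) (Metric.ball 0 1 \ {z})) :
    ∃ E : ℂ × ℂ → ℂ × ℂ, ContinuousOn E (Q ×ˢ Metric.ball 0 1) ∧
      EqOn E F (offDiagonalOver Q) ∧
      (∀ w ∈ Metric.ball (0 : ℂ) 1, DifferentiableOn ℂ (fun z => E (z, w)) Q) ∧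
      (∀ z ∈ Q, DifferentiableOn ℂ (fun w => E (z, w)) (Metric.ball 0 1)) ∧
      MapsTo E (Q ×ˢ Metric.ball 0 1) (Q ×ˢ Metric.ball 0 1) := by
  have hbound : ∀ z ∈ Q, ∀ w ∈ Metric.ball (0 : ℂ) 1, w ≠ z → ‖F (z, w)‖ ≤ 1 := by
    intro z hz w hw hne
    obtain ⟨h1, h2, -⟩ := hF (show (z, w) ∈ offDiagonalOver Q from ⟨hz, hw, hne⟩)
    have h1' := hQ.subset_ball h1
    rw [mem_ball_zero_iff] at h1' h2
    exact max_le h1'.le h2.le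
  obtain ⟨E, hc, he, h1, h2⟩ :=
    exists_extension_across_diagonal_prod hQ.isOpen Metric.isOpen_ball hF₁ hF₂ hbound
  refine ⟨E, hc, fun p hp => he p.1 hp.1 p.2 hp.2.1 hp.2.2, h1, h2, ?_⟩
  rintro ⟨z, w⟩ ⟨hz, hw⟩
  rcases eq_or_ne w z with rfl | hne
  · have hconn : IsPreconnected (Metric.ball (0 : ℂ) 1) := (convex_ball _ _).isPreconnected
    have hmaps : ∀ x ∈ Metric.ball (0 : ℂ) 1, x ≠ w → E (w, x) ∈ offDiagonalOver Q := by
      intro x hx hne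
      rw [he w hz x hx hne]
      exact hF ⟨hz, hx, hne⟩
    refine ⟨mem_of_interior_closure_subset Metric.isOpen_ball hconn hw (h2 w hz).fst
      hQ.interior_closure_subset fun x hx hne => (hmaps x hx hne).1,
      mem_of_interior_closure_subset Metric.isOpen_ball hconn hw (h2 w hz).snd ?_
        fun x hx hne => (hmaps x hx hne).2.1⟩
    rw [closure_ball _ one_ne_zero, interior_closedBall _ one_ne_zero]
  · have hmem : (z, w) ∈ offDiagonalOver Q := ⟨hz, hw, hne⟩
    rw [he z hz w hw hne]
    exact ⟨(hF hmem).1, (hF hmem).2.1⟩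

/-- If `F` and `G` are inverse to each other off the diagonal, the extension of `G` is a left
inverse of the extension of `F`. -/
theorem IsRegularBase.leftInvOn_extension {Q : Set ℂ} (hQ : IsRegularBase Q)
    {F G E H : ℂ × ℂ → ℂ × ℂ} (hF : MapsTo F (offDiagonalOver Q) (offDiagonalOver Q))
    (hGF : LeftInvOn G F (offDiagonalOver Q))
    (hE : ContinuousOn E (Q ×ˢ Metric.ball 0 1)) (hH : ContinuousOn H (Q ×ˢ Metric.ball 0 1))
    (hEF : EqOn E F (offDiagonalOver Q)) (hHG : EqOn H G (offDiagonalOver Q))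
    (hEm : MapsTo E (Q ×ˢ Metric.ball 0 1) (Q ×ˢ Metric.ball 0 1)) :
    LeftInvOn H E (Q ×ˢ Metric.ball 0 1) := by
  have hoff : ∀ p ∈ offDiagonalOver Q, H (E p) = p := by
    intro p hp
    rw [hEF hp, hHG (hF hp), hGF hp]
  rintro ⟨z, w⟩ ⟨hz, hw⟩
  rcases eq_or_ne w z with rfl | hne
  · have hopen : IsOpen (Q ×ˢ Metric.ball (0 : ℂ) 1) := hQ.isOpen.prod Metric.isOpen_ball
    have hcomp : ContinuousAt (fun p => H (E p)) (w, w) :=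
      (hH.comp hE hEm).continuousAt (hopen.mem_nhds ⟨hz, hw⟩)
    have hcont : ContinuousAt (fun x : ℂ => H (E (w, x))) w :=
      hcomp.comp (f := fun x : ℂ => (w, x)) (by fun_prop)
    have ht₁ : Tendsto (fun x : ℂ => H (E (w, x))) (𝓝[≠] w) (𝓝 (H (E (w, w)))) :=
      hcont.tendsto.mono_left inf_le_left
    have ht₂ : Tendsto (fun x : ℂ => (w, x)) (𝓝[≠] w) (𝓝 (w, w)) :=
      ((by fun_prop : Continuous fun x : ℂ => (w, x)).tendsto w).mono_left inf_le_left
    refine tendsto_nhds_unique (ht₁.congr' ?_) ht₂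
    filter_upwards [mem_nhdsWithin_of_mem_nhds (Metric.isOpen_ball.mem_nhds hw),
      self_mem_nhdsWithin] with x hx hne
    exact hoff (w, x) ⟨hz, hx, hne⟩
  · exact hoff (z, w) ⟨hz, hw, hne⟩

/-- A bijection of `Q × Δ`, holomorphic in each variable and with continuous inverse, which maps
the diagonal into itself has the form `(z, w) ↦ (ψ z, ψ w)`. An exchange of the factors is excluded
because it would map the diagonal over `Q` onto the diagonal over the whole disc. -/
theorem IsRegularBase.exists_diagonal_form {Q : Set ℂ} (hQ : IsRegularBase Q)
    {E H : ℂ × ℂ → ℂ × ℂ}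
    (hE₁ : ∀ w ∈ Metric.ball (0 : ℂ) 1, DifferentiableOn ℂ (fun z => E (z, w)) Q)
    (hE₂ : ∀ z ∈ Q, DifferentiableOn ℂ (fun w => E (z, w)) (Metric.ball 0 1))
    (hE : MapsTo E (Q ×ˢ Metric.ball 0 1) (Q ×ˢ Metric.ball 0 1))
    (hH : MapsTo H (Q ×ˢ Metric.ball 0 1) (Q ×ˢ Metric.ball 0 1))
    (hHc : ContinuousOn H (Q ×ˢ Metric.ball 0 1))
    (hHE : LeftInvOn H E (Q ×ˢ Metric.ball 0 1)) (hEH : RightInvOn H E (Q ×ˢ Metric.ball 0 1))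
    (hdiag : ∀ z ∈ Q, (E (z, z)).1 = (E (z, z)).2) :
    ∃ ψ : ℂ → ℂ, DifferentiableOn ℂ ψ (Metric.ball 0 1) ∧
      (∀ z ∈ Q, ∀ w ∈ Metric.ball (0 : ℂ) 1, E (z, w) = (ψ z, ψ w)) ∧
      MapsTo ψ (Metric.ball 0 1) (Metric.ball 0 1) ∧ MapsTo ψ Q Q := by
  have hconn : IsPreconnected (Metric.ball (0 : ℂ) 1) := (convex_ball _ _).isPreconnected
  have hnontriv : ∀ {S : Set ℂ}, IsOpen S → S.Nonempty → S.Nontrivial := by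
    intro S hS hne
    obtain ⟨x, hx⟩ := hne
    have hev : ∀ᶠ y in 𝓝[≠] x, y ∈ S ∧ y ≠ x :=
      inter_mem (mem_nhdsWithin_of_mem_nhds (hS.mem_nhds hx)) self_mem_nhdsWithin
    obtain ⟨y, hy, hyx⟩ := hev.exists
    exact ⟨x, hx, y, hy, Ne.symm hyx⟩
  obtain ⟨z₀, hz₀⟩ := hQ.isConnected.nonempty
  rcases prod_or_swap_of_bijOn_prod hQ.isOpen hQ.isConnected.isPreconnected Metric.isOpen_ball
    hconn hQ.isOpen (Metric.isBounded_ball.subset hQ.subset_ball)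
    (hnontriv hQ.isOpen ⟨z₀, hz₀⟩) Metric.isOpen_ball Metric.isBounded_ball
    (hnontriv Metric.isOpen_ball ⟨0, Metric.mem_ball_self one_pos⟩) hE₁ hE₂ hE hH hHc hHE hEH
    with ⟨h1, h2⟩ | ⟨h1, h2⟩
  · have hform : ∀ z ∈ Q, ∀ w ∈ Metric.ball (0 : ℂ) 1,
        E (z, w) = ((E (z₀, z)).2, (E (z₀, w)).2) := by
      intro z hz w hw
      have hz' := hQ.subset_ball hz
      refine Prod.ext ?_ (h2 z hz z₀ hz₀ w hw)
      exact (h1 z hz w hw z hz').trans ((hdiag z hz).trans (h2 z hz z₀ hz₀ z hz'))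
    refine ⟨fun w => (E (z₀, w)).2, (hE₂ z₀ hz₀).snd, hform,
      fun w hw => (hE (mk_mem_prod hz₀ hw)).2, fun z hz => ?_⟩
    have h3 := (hE (mk_mem_prod hz (hQ.subset_ball hz))).1
    rw [hform z hz z (hQ.subset_ball hz)] at h3
    exact h3
  · exfalso
    obtain ⟨b, hb, hbQ⟩ := hQ.exists_notMem
    have hmem := hH (mk_mem_prod hz₀ hb)
    have heq : E (H (z₀, b)) = (z₀, b) := hEH (mk_mem_prod hz₀ hb)
    have hx' := hQ.subset_ball hmem.1
    have h3 : (E ((H (z₀, b)).1, (H (z₀, b)).2)).2 = b := by rw [Prod.mk.eta, heq]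
    rw [h2 _ hmem.1 _ hmem.2 _ hx', ← hdiag _ hmem.1] at h3
    exact hbQ (h3 ▸ (hE (mk_mem_prod hmem.1 hx')).1)

/-- Every automorphism of `offDiagonalOver Q` is of the form `(z, w) ↦ (ψ z, ψ w)` for an
automorphism `ψ` of the disc preserving `Q`: it extends across the diagonal to an automorphism of
`Q × Δ` which preserves the diagonal. -/
theorem IsRegularBase.exists_isDiscAutPreserving {Q : Set ℂ} (hQ : IsRegularBase Q)
    {F G : ℂ × ℂ → ℂ × ℂ} (hF : MapsTo F (offDiagonalOver Q) (offDiagonalOver Q))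
    (hG : MapsTo G (offDiagonalOver Q) (offDiagonalOver Q))
    (hGF : LeftInvOn G F (offDiagonalOver Q)) (hFG : LeftInvOn F G (offDiagonalOver Q))
    (hF₁ : ∀ w ∈ Metric.ball (0 : ℂ) 1, DifferentiableOn ℂ (fun z => F (z, w)) (Q \ {w}))
    (hF₂ : ∀ z ∈ Q, DifferentiableOn ℂ (fun w => F (z, w)) (Metric.ball 0 1 \ {z}))
    (hG₁ : ∀ w ∈ Metric.ball (0 : ℂ) 1, DifferentiableOn ℂ (fun z => G (z, w)) (Q \ {w}))
    (hG₂ : ∀ z ∈ Q, DifferentiableOn ℂ (fun w => G (z, w)) (Metric.ball 0 1 \ {z})) :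
    ∃ ψ ψ' : ℂ → ℂ, IsDiscAutPreserving Q ψ ψ' ∧
      ∀ p ∈ offDiagonalOver Q, F p = (ψ p.1, ψ p.2) := by
  obtain ⟨E, hEc, hEF, hE₁, hE₂, hE⟩ := hQ.exists_extension hF hF₁ hF₂
  obtain ⟨H, hHc, hHG, hH₁, hH₂, hH⟩ := hQ.exists_extension hG hG₁ hG₂
  have hHE := hQ.leftInvOn_extension hF hGF hEc hHc hEF hHG hE
  have hEH := hQ.leftInvOn_extension hG hFG hHc hEc hHG hEF hH
  -- A diagonal point sent off the diagonal would be in the image of the inverse map.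
  have hdiag : ∀ {E H F G : ℂ × ℂ → ℂ × ℂ}, MapsTo G (offDiagonalOver Q) (offDiagonalOver Q) →
      MapsTo E (Q ×ˢ Metric.ball 0 1) (Q ×ˢ Metric.ball 0 1) → EqOn H G (offDiagonalOver Q) →
      LeftInvOn H E (Q ×ˢ Metric.ball 0 1) → ∀ z ∈ Q, (E (z, z)).1 = (E (z, z)).2 := by
    intro E H F G hG hE hHG hHE z hz
    by_contra hne
    have hmem : (z, z) ∈ Q ×ˢ Metric.ball (0 : ℂ) 1 := ⟨hz, hQ.subset_ball hz⟩
    have hoff : E (z, z) ∈ offDiagonalOver Q := ⟨(hE hmem).1, (hE hmem).2, Ne.symm hne⟩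
    have h1 := hG hoff
    rw [← hHG hoff, hHE hmem] at h1
    exact h1.2.2 rfl
  obtain ⟨ψ, hψ, hψE, hψm, hψQ⟩ := hQ.exists_diagonal_form hE₁ hE₂ hE hH hHc hHE hEH
    (hdiag (F := F) hG hE hHG hHE)
  obtain ⟨ψ', hψ', hψH, hψm', hψQ'⟩ := hQ.exists_diagonal_form hH₁ hH₂ hH hE hEc hEH hHE
    (hdiag (F := G) hF hH hEF hEH)
  obtain ⟨z₀, hz₀⟩ := hQ.isConnected.nonempty
  refine ⟨ψ, ψ', ⟨hψ, hψ', hψm, hψm', fun w hw => ?_, fun w hw => ?_, hψQ, hψQ'⟩, ?_⟩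
  · have h := hHE (mk_mem_prod hz₀ hw)
    rw [hψE z₀ hz₀ w hw, hψH _ (hψQ hz₀) _ (hψm hw)] at h
    exact (Prod.ext_iff.1 h).2
  · have h := hEH (mk_mem_prod hz₀ hw)
    rw [hψH z₀ hz₀ w hw, hψE _ (hψQ' hz₀) _ (hψm' hw)] at h
    exact (Prod.ext_iff.1 h).2
  · rintro ⟨z, w⟩ hp
    rw [← hEF hp]
    exact hψE z hp.1 w hp.2.1

/-- Every automorphism of `overBase Q` is of the form `(z, w) ↦ (ψ z, ψ w)` for an automorphism
`ψ` of the disc preserving `Q`. -/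
theorem IsRegularBase.exists_isDiscAutPreserving_of_holAut {Q : Set ℂ} (hQ : IsRegularBase Q)
    (f : HolAut (overBase Q)) :
    ∃ ψ ψ' : ℂ → ℂ, IsDiscAutPreserving Q ψ ψ' ∧
      ∀ p : overBase Q, (f.1 p : Cn 2) 0 = ψ ((p : Cn 2) 0) ∧
        (f.1 p : Cn 2) 1 = ψ ((p : Cn 2) 1) := by
  obtain ⟨F, hF, hFf⟩ := f.2.1
  obtain ⟨G, hG, hGf⟩ := f.2.2
  -- The identification of `ℂ × ℂ` with the Euclidean plane.
  have hmem : ∀ p ∈ offDiagonalOver Q, (!₂[p.1, p.2] : Cn 2) ∈ overBase Q := fun p hp => hp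
  have hmaps : ∀ {K : Cn 2 → Cn 2} {k : overBase Q → overBase Q}, (∀ z : overBase Q, K z = k z) →
      MapsTo (fun p : ℂ × ℂ => (K !₂[p.1, p.2] 0, K !₂[p.1, p.2] 1)) (offDiagonalOver Q)
        (offDiagonalOver Q) := by
    intro K k hK p hp
    have h := (k ⟨_, hmem p hp⟩).2
    rw [← hK] at h
    exact h
  have heta : ∀ x : Cn 2, (!₂[x 0, x 1] : Cn 2) = x := by
    intro x
    ext i
    fin_cases i <;> rfl
  have hinv : ∀ {K L : Cn 2 → Cn 2} {k l : overBase Q → overBase Q}, (∀ z : overBase Q, K z = k z) →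
      (∀ z : overBase Q, L z = l z) → (∀ z, l (k z) = z) →
      LeftInvOn (fun p : ℂ × ℂ => (L !₂[p.1, p.2] 0, L !₂[p.1, p.2] 1))
        (fun p : ℂ × ℂ => (K !₂[p.1, p.2] 0, K !₂[p.1, p.2] 1)) (offDiagonalOver Q) := by
    intro K L k l hK hL hlk p hp
    change (L !₂[K !₂[p.1, p.2] 0, K !₂[p.1, p.2] 1] 0, L !₂[K !₂[p.1, p.2] 0, K !₂[p.1, p.2] 1] 1)
      = p
    have h1 : K !₂[p.1, p.2] = k ⟨_, hmem p hp⟩ := hK ⟨_, hmem p hp⟩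
    rw [heta, h1, hL, hlk]
    rfl
  have hd₁ : ∀ {K : Cn 2 → Cn 2}, DifferentiableOn ℂ K (overBase Q) →
      ∀ w ∈ Metric.ball (0 : ℂ) 1, DifferentiableOn ℂ
        (fun z : ℂ => (K !₂[z, w] 0, K !₂[z, w] 1)) (Q \ {w}) := by
    intro K hK w hw
    have h1 : DifferentiableOn ℂ (fun z : ℂ => K !₂[z, w]) (Q \ {w}) := by
      refine hK.comp (Differentiable.differentiableOn ?_) fun z hz =>
        (⟨hz.1, hw, Ne.symm hz.2⟩ : _ ∧ _ ∧ _)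
      rw [differentiable_euclidean]
      intro i
      fin_cases i
      · exact differentiable_id
      · exact differentiable_const _
    rw [differentiableOn_euclidean] at h1
    exact (h1 0).prodMk (h1 1)
  have hd₂ : ∀ {K : Cn 2 → Cn 2}, DifferentiableOn ℂ K (overBase Q) →
      ∀ z ∈ Q, DifferentiableOn ℂ
        (fun w : ℂ => (K !₂[z, w] 0, K !₂[z, w] 1)) (Metric.ball 0 1 \ {z}) := by
    intro K hK z hz
    have h1 : DifferentiableOn ℂ (fun w : ℂ => K !₂[z, w]) (Metric.ball 0 1 \ {z}) := by
      refine hK.comp (Differentiable.differentiableOn ?_) fun w hw =>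
        (⟨hz, hw.1, hw.2⟩ : _ ∧ _ ∧ _)
      rw [differentiable_euclidean]
      intro i
      fin_cases i
      · exact differentiable_const _
      · exact differentiable_id
    rw [differentiableOn_euclidean] at h1
    exact (h1 0).prodMk (h1 1)
  obtain ⟨ψ, ψ', hψ, hform⟩ := hQ.exists_isDiscAutPreserving (hmaps hFf) (hmaps hGf)
    (hinv hFf hGf fun z => f.1.symm_apply_apply z) (hinv hGf hFf fun z => f.1.apply_symm_apply z)
    (hd₁ hF) (hd₂ hF) (hd₁ hG) (hd₂ hG)
  refine ⟨ψ, ψ', hψ, fun p => ?_⟩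
  have h := hform ((p : Cn 2) 0, (p : Cn 2) 1) p.2
  have h1 := Prod.ext_iff.1 h
  simp only [heta] at h1
  rw [hFf] at h1
  exact h1

/-! ### Möbius transformations of the disc -/

/-- The Möbius transformation `z ↦ (z - a) / (1 - conj a * z)`, which for `‖a‖ < 1` is the
automorphism of the unit disc taking `a` to `0`. -/
noncomputable def mobius (a z : ℂ) : ℂ := (z - a) / (1 - starRingEnd ℂ a * z)

theorem one_sub_conj_mul_ne_zero {a z : ℂ} (ha : ‖a‖ < 1) (hz : ‖z‖ ≤ 1) :
    1 - starRingEnd ℂ a * z ≠ 0 := by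
  intro h
  have h1 : ‖starRingEnd ℂ a * z‖ = 1 := by rw [← sub_eq_zero.1 h, norm_one]
  rw [norm_mul, RCLike.norm_conj] at h1
  nlinarith [norm_nonneg a, norm_nonneg z]

theorem sq_norm_one_sub_conj_mul_sub (a z : ℂ) :
    ‖1 - starRingEnd ℂ a * z‖ ^ 2 - ‖z - a‖ ^ 2 = (1 - ‖a‖ ^ 2) * (1 - ‖z‖ ^ 2) := by
  simp only [← Complex.normSq_eq_norm_sq, Complex.normSq_apply, Complex.sub_re, Complex.sub_im,
    Complex.mul_re, Complex.mul_im, Complex.conj_re, Complex.conj_im, Complex.one_re,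
    Complex.one_im]
  ring

theorem norm_mobius_lt_one {a z : ℂ} (ha : ‖a‖ < 1) (hz : ‖z‖ < 1) : ‖mobius a z‖ < 1 := by
  have h0 := one_sub_conj_mul_ne_zero ha hz.le
  rw [mobius, norm_div, div_lt_one (norm_pos_iff.2 h0)]
  have h1 := sq_norm_one_sub_conj_mul_sub a z
  have h2 : 0 < (1 - ‖a‖ ^ 2) * (1 - ‖z‖ ^ 2) := by
    apply mul_pos <;> nlinarith [norm_nonneg a, norm_nonneg z]
  exact lt_of_pow_lt_pow_left₀ 2 (norm_nonneg _) (by linarith)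

theorem mobius_neg_mobius {a z : ℂ} (ha : ‖a‖ < 1) (hz : ‖z‖ < 1) :
    mobius (-a) (mobius a z) = z := by
  have h0 := one_sub_conj_mul_ne_zero ha hz.le
  have h1 := one_sub_conj_mul_ne_zero (a := -a) (by rwa [norm_neg]) (norm_mobius_lt_one ha hz).le
  have h2 : mobius a z * (1 - starRingEnd ℂ a * z) = z - a := div_mul_cancel₀ _ h0
  rw [mobius, div_eq_iff h1, map_neg]
  linear_combination h2

theorem mobius_mobius_neg {a z : ℂ} (ha : ‖a‖ < 1) (hz : ‖z‖ < 1) :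
    mobius a (mobius (-a) z) = z := by
  have h := mobius_neg_mobius (a := -a) (by rwa [norm_neg]) hz
  rwa [neg_neg] at h

theorem mobius_self (a : ℂ) : mobius a a = 0 := by simp [mobius]

theorem mobius_neg_zero (a : ℂ) : mobius (-a) 0 = a := by simp [mobius]

theorem differentiableOn_mobius {a : ℂ} (ha : ‖a‖ < 1) :
    DifferentiableOn ℂ (mobius a) (Metric.ball 0 1) := by
  unfold mobius
  refine DifferentiableOn.div (by fun_prop) (by fun_prop) fun z hz => ?_
  exact one_sub_conj_mul_ne_zero ha (mem_ball_zero_iff.1 hz).le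

/-! ### Automorphisms of the disc -/

theorem IsDiscAutPreserving.symm {Q : Set ℂ} {ψ ψ' : ℂ → ℂ} (h : IsDiscAutPreserving Q ψ ψ') :
    IsDiscAutPreserving Q ψ' ψ :=
  ⟨h.2, h.1, h.4, h.3, h.6, h.5, h.8, h.7⟩

theorem IsDiscAutPreserving.comp {Q : Set ℂ} {ψ ψ' φ φ' : ℂ → ℂ}
    (h : IsDiscAutPreserving Q ψ ψ') (k : IsDiscAutPreserving Q φ φ') :
    IsDiscAutPreserving Q (ψ ∘ φ) (φ' ∘ ψ') where
  differentiableOn := h.differentiableOn.comp k.differentiableOn k.mapsTo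
  differentiableOn_inv := k.differentiableOn_inv.comp h.differentiableOn_inv h.mapsTo_inv
  mapsTo := h.mapsTo.comp k.mapsTo
  mapsTo_inv := k.mapsTo_inv.comp h.mapsTo_inv
  leftInv z hz := by simp only [Function.comp, h.leftInv (k.mapsTo hz), k.leftInv hz]
  rightInv z hz := by simp only [Function.comp, k.rightInv (h.mapsTo_inv hz), h.rightInv hz]
  mapsTo_base := h.mapsTo_base.comp k.mapsTo_base
  mapsTo_base_inv := k.mapsTo_base_inv.comp h.mapsTo_base_inv

/-- An automorphism of the disc preserves the whole disc. -/
theorem IsDiscAutPreserving.toBall {Q : Set ℂ} {ψ ψ' : ℂ → ℂ} (h : IsDiscAutPreserving Q ψ ψ') :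
    IsDiscAutPreserving (Metric.ball 0 1) ψ ψ' :=
  { h with mapsTo_base := h.mapsTo, mapsTo_base_inv := h.mapsTo_inv }

theorem IsDiscAutPreserving.apply_mem_base_iff {Q : Set ℂ} {ψ ψ' : ℂ → ℂ} {z : ℂ}
    (h : IsDiscAutPreserving Q ψ ψ') (hz : z ∈ Metric.ball (0 : ℂ) 1) : ψ z ∈ Q ↔ z ∈ Q :=
  ⟨fun hz' => h.leftInv hz ▸ h.mapsTo_base_inv hz', fun hz' => h.mapsTo_base hz'⟩

theorem isDiscAutPreserving_mobius {a : ℂ} (ha : ‖a‖ < 1) :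
    IsDiscAutPreserving (Metric.ball 0 1) (mobius a) (mobius (-a)) := by
  have ha' : ‖-a‖ < 1 := by rwa [norm_neg]
  have hm : ∀ {b : ℂ}, ‖b‖ < 1 → MapsTo (mobius b) (Metric.ball 0 1) (Metric.ball 0 1) :=
    fun hb z hz => mem_ball_zero_iff.2 (norm_mobius_lt_one hb (mem_ball_zero_iff.1 hz))
  exact ⟨differentiableOn_mobius ha, differentiableOn_mobius ha', hm ha, hm ha',
    fun z hz => mobius_neg_mobius ha (mem_ball_zero_iff.1 hz),
    fun z hz => mobius_mobius_neg ha (mem_ball_zero_iff.1 hz), hm ha, hm ha'⟩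

/-- An automorphism of the disc fixing the origin is a rotation, by the Schwarz lemma applied to
the automorphism and its inverse. -/
theorem IsDiscAutPreserving.eq_rotation {Q : Set ℂ} {ψ ψ' : ℂ → ℂ}
    (h : IsDiscAutPreserving Q ψ ψ') (h0 : ψ 0 = 0) :
    ∃ u : ℂ, ‖u‖ = 1 ∧ ∀ z ∈ Metric.ball (0 : ℂ) 1, ψ z = u * z := by
  have hmem0 : (0 : ℂ) ∈ Metric.ball (0 : ℂ) 1 := Metric.mem_ball_self one_pos
  have h0' : ψ' 0 = 0 := by
    have := h.leftInv hmem0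
    rwa [h0] at this
  have hle := Complex.norm_le_norm_of_mapsTo_ball (z := 1 / 2) h.differentiableOn
    (h.mapsTo.mono_right Metric.ball_subset_closedBall) h0
  have hle' := Complex.norm_le_norm_of_mapsTo_ball (z := ψ (1 / 2)) h.differentiableOn_inv
    (h.mapsTo_inv.mono_right Metric.ball_subset_closedBall) h0'
  have hhalf : (1 / 2 : ℂ) ∈ Metric.ball (0 : ℂ) 1 := by
    rw [mem_ball_zero_iff]; norm_num
  have hnorm : ‖ψ (1 / 2)‖ = ‖(1 / 2 : ℂ)‖ := by
    refine le_antisymm (hle (mem_ball_zero_iff.1 hhalf)) ?_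
    have h1 := hle' (mem_ball_zero_iff.1 (h.mapsTo hhalf))
    rwa [h.leftInv hhalf] at h1
  have hmaps : MapsTo ψ (Metric.ball 0 1) (Metric.closedBall (ψ 0) 1) := by
    rw [h0]
    exact h.mapsTo.mono_right Metric.ball_subset_closedBall
  obtain ⟨u, hu, heq⟩ := Complex.affine_of_mapsTo_ball_of_exists_norm_dslope_eq_div'
    h.differentiableOn hmaps ⟨1 / 2, hhalf, by
      rw [dslope_of_ne _ (by norm_num), slope_def_field, h0, sub_zero, sub_zero, norm_div, hnorm,
        div_self (by norm_num), div_one]⟩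
  refine ⟨u, by rw [hu, div_one], fun z hz => ?_⟩
  have h1 := heq hz
  simp only [h0, sub_zero, zero_add, smul_eq_mul] at h1
  rw [h1, mul_comm]

/-- An automorphism of the disc preserving a concentric annulus `{r < ‖z‖ < 1}` is a rotation:
otherwise a point of the circle `‖z‖ = r` is moved to a point of larger modulus. -/
theorem IsDiscAutPreserving.eq_rotation_of_annulus {r : ℝ} {ψ ψ' : ℂ → ℂ} (hr : 0 < r) (hr' : r < 1)
    (h : IsDiscAutPreserving {z | z ∈ Metric.ball (0 : ℂ) 1 ∧ r < ‖z‖} ψ ψ') :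
    ∃ u : ℂ, ‖u‖ = 1 ∧ ∀ z ∈ Metric.ball (0 : ℂ) 1, ψ z = u * z := by
  refine h.eq_rotation ?_
  by_contra hne
  set a := ψ 0
  have ha : ‖a‖ < 1 := mem_ball_zero_iff.1 (h.mapsTo (Metric.mem_ball_self one_pos))
  have ha0 : 0 < ‖a‖ := norm_pos_iff.2 hne
  obtain ⟨u, hu, heq⟩ := ((isDiscAutPreserving_mobius ha).comp h.toBall).eq_rotation
    (by change mobius a a = 0; exact mobius_self a)
  have hu0 : u ≠ 0 := norm_pos_iff.1 (by rw [hu]; exact one_pos)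
  -- The point of the circle which the rotation part moves to the direction of `a`.
  set z : ℂ := u⁻¹ * (r / ‖a‖ * a) with hz
  have hznorm : ‖z‖ = r := by
    rw [hz, norm_mul, norm_inv, hu, norm_mul, norm_div, Complex.norm_real, Complex.norm_real,
      norm_norm, Real.norm_of_nonneg hr.le]
    field_simp
  have hzball : z ∈ Metric.ball (0 : ℂ) 1 := by rw [mem_ball_zero_iff, hznorm]; exact hr'
  have hψz : ψ z = mobius (-a) (r / ‖a‖ * a) := by
    have h1 := heq z hzball
    simp only [Function.comp] at h1
    rw [← mobius_neg_mobius ha (mem_ball_zero_iff.1 (h.mapsTo hzball)), h1, hz,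
      mul_inv_cancel_left₀ hu0]
  have hval : mobius (-a) (r / ‖a‖ * a) = ((r + ‖a‖) / (1 + r * ‖a‖) : ℝ) * (a / ‖a‖) := by
    have hn : (‖a‖ : ℂ) ≠ 0 := Complex.ofReal_ne_zero.2 ha0.ne'
    have hd : (1 + r * ‖a‖ : ℂ) ≠ 0 := by
      have : (0 : ℝ) < 1 + r * ‖a‖ := by positivity
      exact_mod_cast this.ne'
    have hconj : starRingEnd ℂ a * a = (‖a‖ : ℂ) ^ 2 := Complex.conj_mul' a
    have hden : 1 - starRingEnd ℂ (-a) * (r / ‖a‖ * a) = 1 + r * ‖a‖ := by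
      rw [map_neg]
      calc 1 - -starRingEnd ℂ a * (r / ‖a‖ * a) = 1 + r / ‖a‖ * (starRingEnd ℂ a * a) := by ring
        _ = 1 + r * ‖a‖ := by rw [hconj]; field_simp
    rw [mobius, hden]
    push_cast
    field_simp
    ring
  have hnotmem : ¬ r < ‖ψ z‖ := fun hlt => by
    have h1 := (h.apply_mem_base_iff hzball).1 ⟨h.mapsTo hzball, hlt⟩
    exact absurd h1.2 (by rw [hznorm]; exact lt_irrefl r)
  apply hnotmem
  have hn1 : ‖a / (‖a‖ : ℂ)‖ = 1 := by
    rw [norm_div, Complex.norm_real, norm_norm, div_self ha0.ne']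
  rw [hψz, hval, norm_mul, hn1, mul_one, Complex.norm_real, Real.norm_of_nonneg (by positivity),
    lt_div_iff₀ (by positivity)]
  nlinarith [mul_pos ha0 (show 0 < 1 - r ^ 2 by nlinarith)]

/-- The conjugate of an automorphism of the disc preserving `Q` by an automorphism taking `Q'` to
`Q`. -/
theorem IsDiscAutPreserving.conj {Q Q' : Set ℂ} {ψ ψ' χ χ' : ℂ → ℂ}
    (h : IsDiscAutPreserving Q ψ ψ') (k : IsDiscAutPreserving (Metric.ball 0 1) χ χ')
    (h₁ : MapsTo χ Q' Q) (h₂ : MapsTo χ' Q Q') :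
    IsDiscAutPreserving Q' (χ' ∘ ψ ∘ χ) (χ' ∘ ψ' ∘ χ) :=
  { k.symm.comp (h.toBall.comp k) with
    mapsTo_base := h₂.comp (h.mapsTo_base.comp h₁)
    mapsTo_base_inv := h₂.comp (h.mapsTo_base_inv.comp h₁) }

/-- The rotation by `u` about the point `m`, in the hyperbolic geometry of the disc. -/
noncomputable def rotationAbout (m : ℂ) (u : Circle) (z : ℂ) : ℂ := mobius (-m) (u * mobius m z)

/-- The complement in the unit disc of the closed hyperbolic disc of centre `m` and pseudohyperbolic
radius `r`. -/
def hyperbolicAnnulus (m : ℂ) (r : ℝ) : Set ℂ :=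
  {z | z ∈ Metric.ball (0 : ℂ) 1 ∧ r < ‖mobius m z‖}

theorem IsDiscAutPreserving.eq_rotationAbout {m : ℂ} {r : ℝ} {ψ ψ' : ℂ → ℂ} (hm : ‖m‖ < 1)
    (hr : 0 < r) (hr' : r < 1) (h : IsDiscAutPreserving (hyperbolicAnnulus m r) ψ ψ') :
    ∃ u : Circle, ∀ z ∈ Metric.ball (0 : ℂ) 1, ψ z = rotationAbout m u z := by
  have k := isDiscAutPreserving_mobius hm
  have h₁ : MapsTo (mobius (-m)) {z | z ∈ Metric.ball (0 : ℂ) 1 ∧ r < ‖z‖}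
      (hyperbolicAnnulus m r) := fun z hz =>
    ⟨k.mapsTo_inv hz.1, by rw [mobius_mobius_neg hm (mem_ball_zero_iff.1 hz.1)]; exact hz.2⟩
  have h₂ : MapsTo (mobius m) (hyperbolicAnnulus m r)
      {z | z ∈ Metric.ball (0 : ℂ) 1 ∧ r < ‖z‖} := fun z hz => ⟨k.mapsTo hz.1, hz.2⟩
  obtain ⟨u, hu, heq⟩ := (h.conj k.symm h₁ h₂).eq_rotation_of_annulus hr hr'
  refine ⟨⟨u, mem_sphere_zero_iff_norm.2 hu⟩, fun z hz => ?_⟩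
  have h3 := heq _ (k.mapsTo hz)
  simp only [Function.comp] at h3
  rw [k.leftInv hz] at h3
  change ψ z = mobius (-m) (u * mobius m z)
  rw [← k.leftInv (h.mapsTo hz), h3]

/-! ### The Cayley transform and parabolic automorphisms -/

/-- The Cayley transform from the unit disc to the upper half-plane, taking `1` to infinity. -/
noncomputable def cayley (z : ℂ) : ℂ := Complex.I * (1 + z) / (1 - z)

/-- The inverse of the Cayley transform. -/
noncomputable def cayleyInv (ζ : ℂ) : ℂ := (ζ - Complex.I) / (ζ + Complex.I)

theorem one_sub_ne_zero_of_mem_ball {z : ℂ} (hz : z ∈ Metric.ball (0 : ℂ) 1) : 1 - z ≠ 0 := by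
  intro h
  rw [← sub_eq_zero.1 h, mem_ball_zero_iff, norm_one] at hz
  exact lt_irrefl _ hz

theorem add_I_ne_zero {ζ : ℂ} (hζ : 0 < ζ.im) : ζ + Complex.I ≠ 0 := by
  intro h
  have := congrArg Complex.im h
  simp at this
  linarith

theorem cayley_im (z : ℂ) : (cayley z).im = (1 - ‖z‖ ^ 2) / ‖1 - z‖ ^ 2 := by
  rw [cayley, Complex.div_im, ← Complex.normSq_eq_norm_sq, ← Complex.normSq_eq_norm_sq]
  simp only [Complex.normSq_apply, Complex.sub_re, Complex.sub_im, Complex.add_re, Complex.add_im,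
    Complex.mul_re, Complex.mul_im, Complex.I_re, Complex.I_im, Complex.one_re, Complex.one_im]
  rw [← sub_div]
  congr 1
  ring

theorem cayley_im_pos {z : ℂ} (hz : z ∈ Metric.ball (0 : ℂ) 1) : 0 < (cayley z).im := by
  rw [cayley_im]
  have h1 := norm_pos_iff.2 (one_sub_ne_zero_of_mem_ball hz)
  have h2 := mem_ball_zero_iff.1 hz
  have h3 : 0 < 1 - ‖z‖ ^ 2 := by nlinarith [norm_nonneg z]
  positivity

theorem cayleyInv_mem_ball {ζ : ℂ} (hζ : 0 < ζ.im) : cayleyInv ζ ∈ Metric.ball (0 : ℂ) 1 := by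
  rw [mem_ball_zero_iff, cayleyInv, norm_div, div_lt_one (norm_pos_iff.2 (add_I_ne_zero hζ))]
  refine lt_of_pow_lt_pow_left₀ 2 (norm_nonneg _) ?_
  rw [← Complex.normSq_eq_norm_sq, ← Complex.normSq_eq_norm_sq]
  simp only [Complex.normSq_apply, Complex.sub_re, Complex.sub_im, Complex.add_re, Complex.add_im,
    Complex.I_re, Complex.I_im]
  nlinarith

theorem cayleyInv_cayley {z : ℂ} (hz : z ∈ Metric.ball (0 : ℂ) 1) : cayleyInv (cayley z) = z := by
  have h1 := one_sub_ne_zero_of_mem_ball hz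
  have h2 := add_I_ne_zero (cayley_im_pos hz)
  rw [cayleyInv, div_eq_iff h2, cayley]
  field_simp
  ring

theorem cayley_cayleyInv {ζ : ℂ} (hζ : 0 < ζ.im) : cayley (cayleyInv ζ) = ζ := by
  have h1 := one_sub_ne_zero_of_mem_ball (cayleyInv_mem_ball hζ)
  have h2 := add_I_ne_zero hζ
  rw [cayley, div_eq_iff h1, cayleyInv]
  field_simp
  ring

theorem differentiableOn_cayley : DifferentiableOn ℂ cayley (Metric.ball 0 1) := by
  unfold cayley
  exact DifferentiableOn.div (by fun_prop) (by fun_prop) fun z hz => one_sub_ne_zero_of_mem_ball hz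

theorem differentiableOn_cayleyInv : DifferentiableOn ℂ cayleyInv {ζ | 0 < ζ.im} := by
  unfold cayleyInv
  exact DifferentiableOn.div (by fun_prop) (by fun_prop) fun ζ hζ => add_I_ne_zero hζ

/-- The horodisc `‖z - 1/2‖ ≤ 1/2` corresponds to the half-plane `1 ≤ im ζ`. -/
theorem half_lt_norm_sub_half_iff {z : ℂ} (hz : z ∈ Metric.ball (0 : ℂ) 1) :
    1 / 2 < ‖z - 1 / 2‖ ↔ (cayley z).im < 1 := by
  have h1 := norm_pos_iff.2 (one_sub_ne_zero_of_mem_ball hz)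
  rw [cayley_im, div_lt_one (by positivity), ← sq_lt_sq₀ (by norm_num) (norm_nonneg _)]
  have e1 : ‖z - 1 / 2‖ ^ 2 = z.re ^ 2 - z.re + 1 / 4 + z.im ^ 2 := by
    rw [← Complex.normSq_eq_norm_sq, Complex.normSq_apply]
    simp
    ring
  have e2 : ‖1 - z‖ ^ 2 = z.re ^ 2 - 2 * z.re + 1 + z.im ^ 2 := by
    rw [← Complex.normSq_eq_norm_sq, Complex.normSq_apply]
    simp
    ring
  have e3 : ‖z‖ ^ 2 = z.re ^ 2 + z.im ^ 2 := by
    rw [← Complex.normSq_eq_norm_sq, Complex.normSq_apply]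
    ring
  rw [e1, e2, e3]
  constructor <;> intro h <;> linarith

theorem mem_crescentQ_iff {z : ℂ} (hz : z ∈ Metric.ball (0 : ℂ) 1) :
    z ∈ crescentQ ↔ (cayley z).im < 1 :=
  ⟨fun h => (half_lt_norm_sub_half_iff hz).1 h.2, fun h => ⟨hz, (half_lt_norm_sub_half_iff hz).2 h⟩⟩

/-- The parabolic automorphism of the disc fixing `1` which corresponds to the translation by `t`
of the upper half-plane. -/
noncomputable def parabolic (t : ℝ) (z : ℂ) : ℂ := cayleyInv (cayley z + t)

theorem cayley_add_im_pos {z : ℂ} (hz : z ∈ Metric.ball (0 : ℂ) 1) (t : ℝ) :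
    0 < (cayley z + t).im := by
  simpa using cayley_im_pos hz

theorem cayley_parabolic {z : ℂ} (hz : z ∈ Metric.ball (0 : ℂ) 1) (t : ℝ) :
    cayley (parabolic t z) = cayley z + t :=
  cayley_cayleyInv (cayley_add_im_pos hz t)

theorem parabolic_mem_ball {z : ℂ} (hz : z ∈ Metric.ball (0 : ℂ) 1) (t : ℝ) :
    parabolic t z ∈ Metric.ball (0 : ℂ) 1 :=
  cayleyInv_mem_ball (cayley_add_im_pos hz t)

theorem parabolic_parabolic {z : ℂ} (hz : z ∈ Metric.ball (0 : ℂ) 1) (s t : ℝ) :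
    parabolic s (parabolic t z) = parabolic (s + t) z := by
  rw [parabolic, cayley_parabolic hz, parabolic]
  push_cast
  ring_nf

theorem parabolic_zero {z : ℂ} (hz : z ∈ Metric.ball (0 : ℂ) 1) : parabolic 0 z = z := by
  rw [parabolic, Complex.ofReal_zero, add_zero, cayleyInv_cayley hz]

theorem differentiableOn_parabolic (t : ℝ) :
    DifferentiableOn ℂ (parabolic t) (Metric.ball 0 1) :=
  differentiableOn_cayleyInv.comp (differentiableOn_cayley.add_const _)
    fun _ hz => cayley_add_im_pos hz t

theorem mapsTo_parabolic_crescentQ (t : ℝ) : MapsTo (parabolic t) crescentQ crescentQ := by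
  intro z hz
  rw [mem_crescentQ_iff (parabolic_mem_ball hz.1 t), cayley_parabolic hz.1]
  simpa using (mem_crescentQ_iff hz.1).1 hz

theorem isDiscAutPreserving_parabolic (t : ℝ) :
    IsDiscAutPreserving crescentQ (parabolic t) (parabolic (-t)) where
  differentiableOn := differentiableOn_parabolic t
  differentiableOn_inv := differentiableOn_parabolic (-t)
  mapsTo _ hz := parabolic_mem_ball hz t
  mapsTo_inv _ hz := parabolic_mem_ball hz (-t)
  leftInv z hz := by rw [parabolic_parabolic hz, neg_add_cancel, parabolic_zero hz]
  rightInv z hz := by rw [parabolic_parabolic hz, add_neg_cancel, parabolic_zero hz]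
  mapsTo_base := mapsTo_parabolic_crescentQ t
  mapsTo_base_inv := mapsTo_parabolic_crescentQ (-t)

/-- An automorphism of the disc preserving the crescent moves the origin along the horocycle
bounding the crescent. -/
theorem IsDiscAutPreserving.cayley_apply_zero_im {ψ ψ' : ℂ → ℂ}
    (h : IsDiscAutPreserving crescentQ ψ ψ') : (cayley (ψ 0)).im = 1 := by
  have h0 : (0 : ℂ) ∈ Metric.ball (0 : ℂ) 1 := Metric.mem_ball_self one_pos
  have h0Q : (0 : ℂ) ∉ crescentQ := fun hz => by
    have := hz.2
    norm_num at this
  refine le_antisymm ?_ ?_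
  · by_contra! hlt
    have hcont : ContinuousAt (fun z => (cayley (ψ z)).im) 0 :=
      Complex.continuous_im.continuousAt.comp
        ((differentiableOn_cayley.continuousOn.comp h.differentiableOn.continuousOn
          h.mapsTo).continuousAt (Metric.isOpen_ball.mem_nhds h0))
    -- Negative real numbers close to the origin belong to the crescent.
    have hneg : Tendsto (fun x : ℝ => (-x : ℂ)) (𝓝[>] 0) (𝓝 0) := by
      have : Continuous fun x : ℝ => (-x : ℂ) := by fun_prop
      have h0 := this.tendsto 0
      rw [Complex.ofReal_zero, neg_zero] at h0
      exact h0.mono_left inf_le_left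
    obtain ⟨x, ⟨hx1, hx2⟩, hx0⟩ := ((hneg.eventually ((hcont.eventually (lt_mem_nhds hlt)).and
      (Metric.isOpen_ball.mem_nhds h0))).and self_mem_nhdsWithin).exists
    have hx0' : 0 < x := hx0
    have hxQ : (-x : ℂ) ∈ crescentQ := by
      refine ⟨hx2, ?_⟩
      have e : (-x : ℂ) - 1 / 2 = ((-x - 1 / 2 : ℝ) : ℂ) := by push_cast; ring
      rw [e, Complex.norm_real, Real.norm_eq_abs, abs_of_neg (by linarith)]
      linarith
    have h3 := h.mapsTo_base hxQ
    rw [mem_crescentQ_iff h3.1] at h3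
    linarith
  · by_contra! hlt
    exact h0Q ((h.apply_mem_base_iff h0).1 ((mem_crescentQ_iff (h.mapsTo h0)).2 hlt))

/-- A rotation preserving the crescent is the identity. -/
theorem eq_one_of_rotation_preserves_crescentQ {u : ℂ} (hu : ‖u‖ = 1)
    (h : ∀ z ∈ Metric.ball (0 : ℂ) 1, u * z ∈ crescentQ → z ∈ crescentQ) : u = 1 := by
  have hre : ∀ x : ℝ, x ∈ Ioo (0 : ℝ) 1 → x ≤ u.re := by
    intro x hx
    have hxb : (x : ℂ) ∈ Metric.ball (0 : ℂ) 1 := by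
      rw [mem_ball_zero_iff, Complex.norm_real, Real.norm_of_nonneg hx.1.le]
      exact hx.2
    have hub : u * x ∈ Metric.ball (0 : ℂ) 1 := by
      rw [mem_ball_zero_iff, norm_mul, hu, one_mul]
      exact mem_ball_zero_iff.1 hxb
    have hxQ : (x : ℂ) ∉ crescentQ := by
      intro hQ
      have h1 := hQ.2
      have e : (x : ℂ) - 1 / 2 = ((x - 1 / 2 : ℝ) : ℂ) := by push_cast; ring
      rw [e, Complex.norm_real, Real.norm_eq_abs] at h1
      exact absurd h1 (not_lt.2 (abs_le.2 ⟨by linarith [hx.1], by linarith [hx.2]⟩))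
    have huQ : ¬ 1 / 2 < ‖u * x - 1 / 2‖ := fun hlt => hxQ (h _ hxb ⟨hub, hlt⟩)
    have h1 : ‖u * x - 1 / 2‖ ^ 2 ≤ (1 / 2) ^ 2 :=
      pow_le_pow_left₀ (norm_nonneg _) (not_lt.1 huQ) 2
    have h2 : ‖u * x - 1 / 2‖ ^ 2 = ‖u‖ ^ 2 * x ^ 2 - x * u.re + 1 / 4 := by
      rw [← Complex.normSq_eq_norm_sq, ← Complex.normSq_eq_norm_sq, Complex.normSq_apply,
        Complex.normSq_apply]
      simp
      ring
    rw [h2, hu] at h1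
    have h3 : x * x ≤ x * u.re := by linarith
    exact le_of_mul_le_mul_left h3 hx.1
  have h1 : 1 ≤ u.re := le_of_forall_lt_imp_le_of_dense fun x hx => by
    rcases le_or_gt x 0 with h0 | h0
    · exact h0.trans ((by norm_num : (0 : ℝ) ≤ 1 / 2).trans (hre (1 / 2) (by norm_num)))
    · exact hre x ⟨h0, hx⟩
  have h2 : u.re ^ 2 + u.im ^ 2 = 1 := by
    have h3 : ‖u‖ ^ 2 = 1 := by rw [hu, one_pow]
    rw [← Complex.normSq_eq_norm_sq, Complex.normSq_apply] at h3
    linarith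
  apply Complex.ext
  · rw [Complex.one_re]; nlinarith [sq_nonneg u.im]
  · rw [Complex.one_im]
    have : u.im ^ 2 ≤ 0 := by nlinarith
    exact pow_eq_zero_iff (two_ne_zero) |>.1 (le_antisymm this (sq_nonneg _))

/-- The automorphisms of the disc preserving the crescent are the parabolic transformations fixing
`1`: these act transitively on the horocycle, and the stabilizer of the origin is trivial. -/
theorem IsDiscAutPreserving.eq_parabolic {ψ ψ' : ℂ → ℂ}
    (h : IsDiscAutPreserving crescentQ ψ ψ') :
    ∃ t : ℝ, ∀ z ∈ Metric.ball (0 : ℂ) 1, ψ z = parabolic t z := by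
  have h0 : (0 : ℂ) ∈ Metric.ball (0 : ℂ) 1 := Metric.mem_ball_self one_pos
  set t : ℝ := (cayley (ψ 0)).re
  -- A parabolic automorphism moves `ψ 0` back to the origin.
  have hk := (isDiscAutPreserving_parabolic (-t)).comp h
  have hI : cayley (ψ 0) + (-t : ℝ) = Complex.I := by
    apply Complex.ext
    · simp [t]
    · simp [h.cayley_apply_zero_im]
  obtain ⟨u, hu, heq⟩ := hk.eq_rotation (by
    simp only [Function.comp, parabolic, hI, cayleyInv, sub_self, zero_div])
  have hu1 : u = 1 := eq_one_of_rotation_preserves_crescentQ hu fun z hz hQ =>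
    (hk.apply_mem_base_iff hz).1 (heq z hz ▸ hQ)
  refine ⟨t, fun z hz => ?_⟩
  have h1 := heq z hz
  rw [hu1, one_mul] at h1
  simp only [Function.comp] at h1
  rw [← parabolic_zero (h.mapsTo hz), ← add_neg_cancel t, ← parabolic_parabolic (h.mapsTo hz), h1]

/-! ### Identification of the automorphism groups -/

/-- A continuous action `ρ` of a topological group on the unit disc by holomorphic maps which
preserve `Q`. The values off the disc play no role. -/
structure IsDiscAction {G : Type*} [Group G] [TopologicalSpace G] (Q : Set ℂ)
    (ρ : G → ℂ → ℂ) : Prop where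
  differentiableOn : ∀ g, DifferentiableOn ℂ (ρ g) (Metric.ball 0 1)
  mapsTo : ∀ g, MapsTo (ρ g) (Metric.ball 0 1) (Metric.ball 0 1)
  mapsTo_base : ∀ g, MapsTo (ρ g) Q Q
  one_apply : ∀ z ∈ Metric.ball (0 : ℂ) 1, ρ 1 z = z
  mul_apply : ∀ g h, ∀ z ∈ Metric.ball (0 : ℂ) 1, ρ (g * h) z = ρ g (ρ h z)
  continuousOn : ContinuousOn (fun p : G × ℂ => ρ p.1 p.2) (univ ×ˢ Metric.ball 0 1)

section DiagonalAction

variable {G : Type*} [Group G] [TopologicalSpace G] {Q : Set ℂ} {ρ : G → ℂ → ℂ}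

theorem IsDiscAction.inv_apply (h : IsDiscAction Q ρ) (g : G) {z : ℂ}
    (hz : z ∈ Metric.ball (0 : ℂ) 1) : ρ g⁻¹ (ρ g z) = z := by
  rw [← h.mul_apply _ _ z hz, inv_mul_cancel, h.one_apply z hz]

theorem IsDiscAction.diagonal_mem (h : IsDiscAction Q ρ) (hQ : Q ⊆ Metric.ball 0 1) (g : G)
    {p : Cn 2} (hp : p ∈ overBase Q) : (!₂[ρ g (p 0), ρ g (p 1)] : Cn 2) ∈ overBase Q := by
  refine ⟨h.mapsTo_base g hp.1, h.mapsTo g hp.2.1, fun heq => hp.2.2 ?_⟩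
  have h1 : ρ g (p 1) = ρ g (p 0) := heq
  rw [← h.inv_apply g hp.2.1, h1, h.inv_apply g (hQ hp.1)]

/-- The map `(z, w) ↦ (ρ g z, ρ g w)` as a self-map of `overBase Q`. -/
noncomputable def IsDiscAction.diagonalMap (h : IsDiscAction Q ρ) (hQ : Q ⊆ Metric.ball 0 1)
    (g : G) (p : overBase Q) : overBase Q :=
  ⟨!₂[ρ g ((p : Cn 2) 0), ρ g ((p : Cn 2) 1)], h.diagonal_mem hQ g p.2⟩

theorem overBase_ext {p q : overBase Q} (h0 : (p : Cn 2) 0 = (q : Cn 2) 0)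
    (h1 : (p : Cn 2) 1 = (q : Cn 2) 1) : p = q := by
  apply Subtype.ext
  ext i
  fin_cases i
  · exact h0
  · exact h1

theorem IsDiscAction.diagonalMap_mul (h : IsDiscAction Q ρ) (hQ : Q ⊆ Metric.ball 0 1) (g k : G)
    (p : overBase Q) : h.diagonalMap hQ (g * k) p = h.diagonalMap hQ g (h.diagonalMap hQ k p) :=
  overBase_ext (h.mul_apply g k _ (hQ p.2.1)) (h.mul_apply g k _ p.2.2.1)

theorem IsDiscAction.diagonalMap_one (h : IsDiscAction Q ρ) (hQ : Q ⊆ Metric.ball 0 1)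
    (p : overBase Q) : h.diagonalMap hQ 1 p = p :=
  overBase_ext (h.one_apply _ (hQ p.2.1)) (h.one_apply _ p.2.2.1)

theorem IsDiscAction.isHolomorphicSelfMap (h : IsDiscAction Q ρ) (hQ : Q ⊆ Metric.ball 0 1)
    (g : G) : IsHolomorphicSelfMap (h.diagonalMap hQ g) := by
  refine ⟨fun p => !₂[ρ g (p 0), ρ g (p 1)], ?_, fun _ => rfl⟩
  have hproj : ∀ i : Fin 2, DifferentiableOn ℂ (fun p : Cn 2 => p i) (overBase Q) := fun i =>
    (differentiable_euclidean.1 differentiable_id i).differentiableOn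
  rw [differentiableOn_euclidean]
  intro i
  fin_cases i
  · exact (h.differentiableOn g).comp (hproj 0) fun p hp => hQ hp.1
  · exact (h.differentiableOn g).comp (hproj 1) fun p hp => hp.2.1

/-- The homomorphism to the automorphism group of `overBase Q` defined by the diagonal action. -/
noncomputable def IsDiscAction.toHolAut (h : IsDiscAction Q ρ) (hQ : Q ⊆ Metric.ball 0 1) :
    G →* HolAut (overBase Q) where
  toFun g := (⟨{ toFun := h.diagonalMap hQ g
                 invFun := h.diagonalMap hQ g⁻¹
                 left_inv := fun p => by
                  rw [← h.diagonalMap_mul, inv_mul_cancel, h.diagonalMap_one]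
                 right_inv := fun p => by
                  rw [← h.diagonalMap_mul, mul_inv_cancel, h.diagonalMap_one] },
    h.isHolomorphicSelfMap hQ g, h.isHolomorphicSelfMap hQ g⁻¹⟩ : biholSubgroup (overBase Q))
  map_one' := Subtype.ext (Equiv.ext fun p => h.diagonalMap_one hQ p)
  map_mul' g k := Subtype.ext (Equiv.ext fun p => h.diagonalMap_mul hQ g k p)

theorem IsDiscAction.toHolAut_apply (h : IsDiscAction Q ρ) (hQ : Q ⊆ Metric.ball 0 1) (g : G)
    (p : overBase Q) : (h.toHolAut hQ g).1 p = h.diagonalMap hQ g p := rfl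

theorem IsDiscAction.continuous_toHolAut (h : IsDiscAction Q ρ) (hQ : Q ⊆ Metric.ball 0 1) :
    Continuous (h.toHolAut hQ) := by
  rw [continuous_induced_rng]
  refine ContinuousMap.continuous_of_continuous_uncurry _ ?_
  refine Continuous.subtype_mk (f := fun x : G × overBase Q =>
    (!₂[ρ x.1 ((x.2 : Cn 2) 0), ρ x.1 ((x.2 : Cn 2) 1)] : Cn 2)) ?_ _
  refine (PiLp.continuous_toLp 2 _).comp (continuous_pi fun i => ?_)
  have hproj : ∀ i : Fin 2, Continuous fun x : G × overBase Q => (x.1, (x.2 : Cn 2) i) :=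
    fun i => by fun_prop
  fin_cases i
  · exact h.continuousOn.comp_continuous (hproj 0) fun x => ⟨mem_univ _, hQ x.2.2.1⟩
  · exact h.continuousOn.comp_continuous (hproj 1) fun x => ⟨mem_univ _, x.2.2.2.1⟩

theorem IsDiscAction.toHolAut_injective (h : IsDiscAction Q ρ) (hQ : Q ⊆ Metric.ball 0 1)
    (p : overBase Q) (hp : Function.Injective fun g => ρ g ((p : Cn 2) 0)) :
    Function.Injective (h.toHolAut hQ) := by
  intro g k hgk
  apply hp
  have h1 := congrArg (fun f : HolAut (overBase Q) => (f.1 p : Cn 2) 0) hgk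
  exact h1

theorem IsDiscAction.toHolAut_surjective (h : IsDiscAction Q ρ) (hQ : IsRegularBase Q)
    (hρ : ∀ ψ ψ', IsDiscAutPreserving Q ψ ψ' → ∃ g, ∀ z ∈ Metric.ball (0 : ℂ) 1, ψ z = ρ g z) :
    Function.Surjective (h.toHolAut hQ.subset_ball) := by
  intro f
  obtain ⟨ψ, ψ', hψ, hf⟩ := hQ.exists_isDiscAutPreserving_of_holAut f
  obtain ⟨g, hg⟩ := hρ ψ ψ' hψ
  refine ⟨g, Subtype.ext (Equiv.ext fun p => ?_)⟩
  rw [h.toHolAut_apply]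
  refine overBase_ext ?_ ?_
  · rw [(hf p).1, hg _ (hQ.subset_ball p.2.1)]
    rfl
  · rw [(hf p).2, hg _ p.2.2.1]
    rfl

end DiagonalAction

theorem HolAut.toContinuousMap_injective {n : ℕ} {D : Set (Cn n)} :
    Function.Injective (HolAut.toContinuousMap : HolAut D → C(D, D)) := fun _ _ h =>
  Subtype.ext (Equiv.ext fun p => DFunLike.congr_fun h p)

theorem HolAut.t2Space {n : ℕ} (D : Set (Cn n)) : T2Space (HolAut D) :=
  T2Space.of_injective_continuous HolAut.toContinuousMap_injective continuous_induced_dom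

theorem HolAut.continuous_eval {n : ℕ} {D : Set (Cn n)} (p : D) :
    Continuous fun f : HolAut D => f.1 p := by
  have h : Continuous (HolAut.toContinuousMap : HolAut D → C(D, D)) := continuous_induced_dom
  have hev : Continuous fun φ : C(D, D) => φ p := continuous_eval_const p
  exact hev.comp h

/-- A continuous bijective homomorphism with continuous inverse as an isomorphism of topological
groups. -/
theorem nonempty_continuousMulEquiv_of_bijective {G H : Type*} [Group G] [Group H]
    [TopologicalSpace G] [TopologicalSpace H] (φ : G →* H) (hφ : Function.Bijective φ)
    (hc : Continuous φ) (s : H → G) (hs : Continuous s) (hsφ : ∀ g, s (φ g) = g) :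
    Nonempty (H ≃ₜ* G) := by
  have hinv : ∀ x, (MulEquiv.ofBijective φ hφ).symm x = s x := by
    intro x
    obtain ⟨g, rfl⟩ := hφ.2 x
    rw [hsφ]
    exact (MulEquiv.ofBijective φ hφ).symm_apply_apply g
  exact ⟨{ (MulEquiv.ofBijective φ hφ).symm with
    continuous_toFun := hs.congr fun x => (hinv x).symm
    continuous_invFun := hc }⟩

theorem isDiscAction_rotationAbout {m : ℂ} (hm : ‖m‖ < 1) (r : ℝ) :
    IsDiscAction (hyperbolicAnnulus m r) (rotationAbout m) := by
  have k := isDiscAutPreserving_mobius hm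
  have hrot : ∀ (u : Circle) (z : ℂ), ‖(u : ℂ) * z‖ = ‖z‖ := fun u z => by
    rw [norm_mul, Circle.norm_coe, one_mul]
  have hmem : ∀ (u : Circle), ∀ z ∈ Metric.ball (0 : ℂ) 1,
      (u : ℂ) * mobius m z ∈ Metric.ball (0 : ℂ) 1 := fun u z hz => by
    rw [mem_ball_zero_iff, hrot]
    exact mem_ball_zero_iff.1 (k.mapsTo hz)
  have hval : ∀ (u : Circle), ∀ z ∈ Metric.ball (0 : ℂ) 1,
      mobius m (rotationAbout m u z) = u * mobius m z := fun u z hz => k.rightInv (hmem u z hz)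
  have hcont : Continuous fun p : Circle × ℂ => (p.1 : ℂ) * p.2 := by fun_prop
  refine ⟨fun u => k.differentiableOn_inv.comp (k.differentiableOn.const_mul _) (hmem u),
    fun u z hz => k.mapsTo_inv (hmem u z hz), fun u z hz => ⟨k.mapsTo_inv (hmem u z hz.1), ?_⟩,
    fun z hz => ?_, fun u v z hz => ?_, ?_⟩
  · rw [hval u z hz.1, hrot]
    exact hz.2
  · rw [rotationAbout, Circle.coe_one, one_mul, k.leftInv hz]
  · rw [rotationAbout, rotationAbout, hval v z hz, Circle.coe_mul, mul_assoc]
  · refine k.differentiableOn_inv.continuousOn.comp (hcont.comp_continuousOn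
      (continuousOn_fst.prodMk (k.differentiableOn.continuousOn.comp continuousOn_snd
        fun p hp => hp.2))) fun p hp => hmem p.1 p.2 hp.2

/-- The automorphism group of `overBase Q`, for the complement `Q` of a closed hyperbolic disc, is
the circle of rotations about the centre of the disc. -/
theorem nonempty_holAut_hyperbolicAnnulus {m : ℂ} {r : ℝ} (hm : ‖m‖ < 1) (hr : 0 < r) (hr' : r < 1)
    (hQ : IsRegularBase (hyperbolicAnnulus m r)) :
    Nonempty (HolAut (overBase (hyperbolicAnnulus m r)) ≃ₜ* Circle) := by
  have k := isDiscAutPreserving_mobius hm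
  have h := isDiscAction_rotationAbout hm r
  obtain ⟨z₀, hz₀⟩ := hQ.isConnected.nonempty
  have hm0 : (m : ℂ) ≠ z₀ := by
    rintro rfl
    have h1 := hz₀.2
    rw [mobius_self, norm_zero] at h1
    exact absurd h1 (not_lt.2 hr.le)
  let p : overBase (hyperbolicAnnulus m r) :=
    ⟨!₂[z₀, m], hz₀, mem_ball_zero_iff.2 hm, hm0⟩
  have hinj : Function.Injective fun u => rotationAbout m u z₀ := by
    intro u v huv
    have hmem : ∀ u : Circle, (u : ℂ) * mobius m z₀ ∈ Metric.ball (0 : ℂ) 1 := fun u => by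
      rw [mem_ball_zero_iff, norm_mul, Circle.norm_coe, one_mul]
      exact mem_ball_zero_iff.1 (k.mapsTo hz₀.1)
    have h1 := congrArg (mobius m) huv
    simp only [rotationAbout] at h1
    rw [k.rightInv (hmem u), k.rightInv (hmem v)] at h1
    exact Circle.ext (mul_right_cancel₀ (norm_pos_iff.1 (hr.trans hz₀.2)) h1)
  have hbij : Function.Bijective (h.toHolAut hQ.subset_ball) :=
    ⟨h.toHolAut_injective hQ.subset_ball p hinj,
      h.toHolAut_surjective hQ fun ψ ψ' hψ => hψ.eq_rotationAbout hm hr hr'⟩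
  have := HolAut.t2Space (overBase (hyperbolicAnnulus m r))
  have hc := h.continuous_toHolAut hQ.subset_ball
  let e := Continuous.homeoOfEquivCompactToT2 (f := Equiv.ofBijective _ hbij) hc
  exact nonempty_continuousMulEquiv_of_bijective _ hbij hc e.symm e.symm.continuous
    fun g => e.symm_apply_apply g

theorem isDiscAction_parabolic :
    IsDiscAction crescentQ fun t : Multiplicative ℝ => parabolic t.toAdd := by
  refine ⟨fun t => differentiableOn_parabolic _, fun t z hz => parabolic_mem_ball hz _,
    fun t => mapsTo_parabolic_crescentQ _, fun z hz => parabolic_zero hz,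
    fun s t z hz => (parabolic_parabolic hz _ _).symm, ?_⟩
  have hcont : Continuous fun p : Multiplicative ℝ × ℂ => p.2 + ((p.1.toAdd : ℝ) : ℂ) :=
    continuous_snd.add (Complex.continuous_ofReal.comp (continuous_toAdd.comp continuous_fst))
  exact differentiableOn_cayleyInv.continuousOn.comp (hcont.comp_continuousOn
    (continuousOn_fst.prodMk (differentiableOn_cayley.continuousOn.comp continuousOn_snd
      fun p hp => hp.2))) fun p hp => cayley_add_im_pos hp.2 _

/-- The automorphism group of `overBase crescentQ` is the group of parabolic transformations
preserving the crescent; the translation parameter is recovered continuously from the image of a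
point. -/
theorem nonempty_holAut_crescentQ (hQ : IsRegularBase crescentQ) :
    Nonempty (HolAut (overBase crescentQ) ≃ₜ* Multiplicative ℝ) := by
  have h := isDiscAction_parabolic
  obtain ⟨z₀, hz₀⟩ := hQ.isConnected.nonempty
  have h0 : (0 : ℂ) ≠ z₀ := by
    rintro rfl
    have h1 := hz₀.2
    norm_num at h1
  let p : overBase crescentQ := ⟨!₂[z₀, 0], hz₀, Metric.mem_ball_self one_pos, h0⟩
  let s : HolAut (overBase crescentQ) → Multiplicative ℝ := fun f =>
    Multiplicative.ofAdd ((cayley ((f.1 p : Cn 2) 0)).re - (cayley z₀).re)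
  have hs : Continuous s := by
    have h1 : Continuous fun f : HolAut (overBase crescentQ) => (f.1 p : Cn 2) 0 :=
      (by fun_prop : Continuous fun q : overBase crescentQ => (q : Cn 2) 0).comp
        (HolAut.continuous_eval p)
    have h2 : Continuous fun f : HolAut (overBase crescentQ) => cayley ((f.1 p : Cn 2) 0) :=
      differentiableOn_cayley.continuousOn.comp_continuous h1 fun f => hQ.subset_ball (f.1 p).2.1
    exact continuous_ofAdd.comp ((Complex.continuous_re.comp h2).sub continuous_const)
  have hsφ : ∀ t, s (h.toHolAut hQ.subset_ball t) = t := by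
    intro t
    change Multiplicative.ofAdd ((cayley (parabolic t.toAdd z₀)).re - (cayley z₀).re) = t
    rw [cayley_parabolic hz₀.1, Complex.add_re, Complex.ofReal_re, add_sub_cancel_left]
    rfl
  exact nonempty_continuousMulEquiv_of_bijective _
    ⟨Function.LeftInverse.injective hsφ,
      h.toHolAut_surjective hQ fun ψ ψ' hψ => hψ.eq_parabolic⟩
    (h.continuous_toHolAut hQ.subset_ball) s hs hsφ

/-! ### Maximal compact subgroups -/

theorem isMaximalCompactSubgroup_iff_eq_top {G : Type*} [Group G] [TopologicalSpace G]
    [CompactSpace G] (K : Subgroup G) : IsMaximalCompactSubgroup K ↔ K = ⊤ := by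
  have htop : IsCompact ((⊤ : Subgroup G) : Set G) := isCompact_univ
  refine ⟨fun h => top_le_iff.1 (h.2 htop le_top), ?_⟩
  rintro rfl
  exact ⟨htop, fun _ _ _ => le_top⟩

/-- The real line has no nontrivial compact subgroup: the multiples of a nonzero number are
unbounded. -/
theorem isMaximalCompactSubgroup_iff_eq_bot {G : Type*} [Group G] [TopologicalSpace G]
    (e : G ≃ₜ* Multiplicative ℝ) (K : Subgroup G) : IsMaximalCompactSubgroup K ↔ K = ⊥ := by
  have key : ∀ H : Subgroup G, IsCompact (H : Set G) → H = ⊥ := by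
    intro H hH
    rw [Subgroup.eq_bot_iff_forall]
    intro x hx
    have hcont : Continuous fun y : G => (e y).toAdd := continuous_toAdd.comp e.continuous
    obtain ⟨M, hM⟩ := (hH.image hcont).isBounded.exists_norm_le
    have hle : ∀ n : ℕ, n * |(e x).toAdd| ≤ M := by
      intro n
      have h1 := hM _ (mem_image_of_mem _ (H.pow_mem hx n))
      rw [map_pow, toAdd_pow, nsmul_eq_mul, norm_mul, Real.norm_natCast] at h1
      exact h1
    have hzero : (e x).toAdd = 0 := by
      by_contra hne
      obtain ⟨n, hn⟩ := exists_nat_gt (M / |(e x).toAdd|)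
      rw [div_lt_iff₀ (abs_pos.2 hne)] at hn
      exact absurd (hle n) (not_le.2 hn)
    have h1 : e x = 1 := hzero
    exact (map_eq_one_iff e e.injective).1 h1
  have hbot : IsCompact ((⊥ : Subgroup G) : Set G) := by
    rw [Subgroup.coe_bot]
    exact isCompact_singleton
  refine ⟨fun h => key K h.1, ?_⟩
  rintro rfl
  exact ⟨hbot, fun H hH _ => (key H hH).le⟩

/-! ### The base domains -/

/-- The unit disc with the closed disc of centre `c` and radius `1/2` removed. -/
def discMinusDisc (c : ℝ) : Set ℂ := {z | z ∈ Metric.ball (0 : ℂ) 1 ∧ 1 / 2 < ‖z - c‖}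

theorem annulusQ_eq_discMinusDisc (j : ℕ) : annulusQ j = discMinusDisc (1 / 2 - (1 / 2) ^ j) := by
  ext z
  have e : z - 1 / 2 + (1 / 2) ^ j = z - ((1 / 2 - (1 / 2) ^ j : ℝ) : ℂ) := by
    push_cast
    ring
  simp only [annulusQ, discMinusDisc, mem_ofPred_eq, e]

theorem crescentQ_eq_discMinusDisc : crescentQ = discMinusDisc (1 / 2) := by
  ext z
  have e : z - 1 / 2 = z - ((1 / 2 : ℝ) : ℂ) := by push_cast; ring
  simp only [crescentQ, discMinusDisc, mem_ofPred_eq, e]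

theorem isOpen_discMinusDisc (c : ℝ) : IsOpen (discMinusDisc c) :=
  Metric.isOpen_ball.inter
    (isOpen_lt continuous_const (by fun_prop : Continuous fun z : ℂ => ‖z - c‖))

/-- A round disc of centre `c` and radius `1/2` inside the unit disc is a hyperbolic disc. Its
hyperbolic centre `m` is a root of a quadratic polynomial, and the pseudohyperbolic radius is
computed at the boundary point `c + 1/2`. -/
theorem exists_discMinusDisc_eq_hyperbolicAnnulus {c : ℝ} (hc : 0 ≤ c) (hc' : c < 1 / 2) :
    ∃ m : ℂ, ∃ r : ℝ, ‖m‖ < 1 ∧ 0 < r ∧ r < 1 ∧ discMinusDisc c = hyperbolicAnnulus m r := by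
  obtain ⟨m, ⟨hm0, hm1⟩, hp⟩ : ∃ m ∈ Ico (0 : ℝ) (c + 1 / 2),
      c * m ^ 2 - (3 / 4 + c ^ 2) * m + c = 0 := by
    have hcont : ContinuousOn (fun m : ℝ => c * m ^ 2 - (3 / 4 + c ^ 2) * m + c)
        (Icc 0 (c + 1 / 2)) := by fun_prop
    have hneg : c * (c + 1 / 2) ^ 2 - (3 / 4 + c ^ 2) * (c + 1 / 2) + c < 0 := by nlinarith
    obtain ⟨m, hm, hpm⟩ := intermediate_value_Icc' (by linarith) hcont
      (show (0 : ℝ) ∈ _ from ⟨hneg.le, by simpa using hc⟩)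
    refine ⟨m, ⟨hm.1, lt_of_le_of_ne hm.2 ?_⟩, hpm⟩
    rintro rfl
    exact hneg.ne hpm
  set b : ℝ := c + 1 / 2 with hb
  have hb1 : b < 1 := by linarith
  have hmb : 0 < 1 - m * b := by nlinarith
  have hm1' : m < 1 := hm1.trans hb1
  have hmnorm : ‖(m : ℂ)‖ < 1 := by rwa [Complex.norm_real, Real.norm_of_nonneg hm0]
  refine ⟨m, (b - m) / (1 - m * b), hmnorm, div_pos (by linarith) hmb, ?_, ?_⟩
  · rw [div_lt_one hmb]
    nlinarith
  ext z
  refine and_congr_right fun hz => ?_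
  have hden : 0 < ‖1 - starRingEnd ℂ (m : ℂ) * z‖ :=
    norm_pos_iff.2 (one_sub_conj_mul_ne_zero hmnorm (mem_ball_zero_iff.1 hz).le)
  rw [mobius, norm_div, div_lt_div_iff₀ hmb hden, ← sq_lt_sq₀ (by norm_num) (norm_nonneg _),
    ← sq_lt_sq₀ (mul_nonneg (by linarith) hden.le) (by positivity), mul_pow, mul_pow]
  have e1 : ‖z - c‖ ^ 2 = (z.re - c) ^ 2 + z.im ^ 2 := by
    rw [← Complex.normSq_eq_norm_sq, Complex.normSq_apply]
    simp
    ring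
  have e2 : ‖z - m‖ ^ 2 = (z.re - m) ^ 2 + z.im ^ 2 := by
    rw [← Complex.normSq_eq_norm_sq, Complex.normSq_apply]
    simp
    ring
  have e3 : ‖1 - starRingEnd ℂ (m : ℂ) * z‖ ^ 2 = (1 - m * z.re) ^ 2 + m ^ 2 * z.im ^ 2 := by
    rw [← Complex.normSq_eq_norm_sq, Complex.normSq_apply]
    simp
    ring
  have hK : 0 < (1 - 2 * m * b + m ^ 2) * (1 - m ^ 2) := by
    apply mul_pos <;> nlinarith
  have key : ((z.re - m) ^ 2 + z.im ^ 2) * (1 - m * b) ^ 2 -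
      (b - m) ^ 2 * ((1 - m * z.re) ^ 2 + m ^ 2 * z.im ^ 2) =
      (1 - 2 * m * b + m ^ 2) * (1 - m ^ 2) * ((z.re - c) ^ 2 + z.im ^ 2 - (1 / 2) ^ 2) := by
    rw [hb]
    linear_combination (2 * (1 - m ^ 2) * (z.re - (c + 1 / 2))) * hp
  rw [e1, e2, e3, ← sub_pos, ← sub_pos (a := _ * (1 - m * b) ^ 2), key, mul_pos_iff_of_pos_left hK]

theorem isConnected_annulus {r : ℝ} (hr : 0 ≤ r) (hr' : r < 1) :
    IsConnected {z | z ∈ Metric.ball (0 : ℂ) 1 ∧ r < ‖z‖} := by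
  have himage : {z | z ∈ Metric.ball (0 : ℂ) 1 ∧ r < ‖z‖} =
      (fun p : ℝ × ℝ => (p.1 : ℂ) * Complex.exp (p.2 * Complex.I)) '' (Ioo r 1 ×ˢ univ) := by
    ext z
    constructor
    · rintro ⟨h1, h2⟩
      exact ⟨(‖z‖, z.arg), ⟨⟨h2, mem_ball_zero_iff.1 h1⟩, mem_univ _⟩,
        Complex.norm_mul_exp_arg_mul_I z⟩
    · rintro ⟨⟨s, θ⟩, ⟨⟨h1, h2⟩, -⟩, rfl⟩
      have hnorm : ‖(s : ℂ) * Complex.exp (θ * Complex.I)‖ = s := by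
        rw [norm_mul, Complex.norm_exp_ofReal_mul_I, mul_one, Complex.norm_real,
          Real.norm_of_nonneg (hr.trans h1.le)]
      exact ⟨by rw [mem_ball_zero_iff, hnorm]; exact h2, by rw [hnorm]; exact h1⟩
  rw [himage]
  exact ((isConnected_Ioo hr').prod isConnected_univ).image _ (by fun_prop)

theorem isConnected_hyperbolicAnnulus {m : ℂ} {r : ℝ} (hm : ‖m‖ < 1) (hr : 0 ≤ r) (hr' : r < 1) :
    IsConnected (hyperbolicAnnulus m r) := by
  have k := isDiscAutPreserving_mobius hm
  have himage : hyperbolicAnnulus m r =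
      mobius (-m) '' {z | z ∈ Metric.ball (0 : ℂ) 1 ∧ r < ‖z‖} := by
    ext z
    constructor
    · rintro ⟨h1, h2⟩
      exact ⟨mobius m z, ⟨k.mapsTo h1, h2⟩, k.leftInv h1⟩
    · rintro ⟨ξ, ⟨h1, h2⟩, rfl⟩
      exact ⟨k.mapsTo_inv h1, by rw [k.rightInv h1]; exact h2⟩
  rw [himage]
  exact (isConnected_annulus hr hr').image _
    (k.differentiableOn_inv.continuousOn.mono fun z hz => hz.1)

theorem isConnected_crescentQ : IsConnected crescentQ := by
  have himage : crescentQ = cayleyInv '' {ζ | 0 < ζ.im ∧ ζ.im < 1} := by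
    ext z
    constructor
    · intro hz
      exact ⟨cayley z, ⟨cayley_im_pos hz.1, (mem_crescentQ_iff hz.1).1 hz⟩, cayleyInv_cayley hz.1⟩
    · rintro ⟨ζ, ⟨h1, h2⟩, rfl⟩
      rw [mem_crescentQ_iff (cayleyInv_mem_ball h1), cayley_cayleyInv h1]
      exact h2
  rw [himage]
  have hconv : Convex ℝ {ζ : ℂ | 0 < ζ.im ∧ ζ.im < 1} :=
    (convex_halfSpace_im_gt 0).inter (convex_halfSpace_im_lt 1)
  refine (hconv.isConnected ⟨Complex.I / 2, ?_⟩).image _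
    (differentiableOn_cayleyInv.continuousOn.mono fun ζ hζ => hζ.1)
  simp
  norm_num

theorem isConnected_discMinusDisc {c : ℝ} (hc : 0 ≤ c) (hc' : c ≤ 1 / 2) :
    IsConnected (discMinusDisc c) := by
  rcases hc'.lt_or_eq with hlt | rfl
  · obtain ⟨m, r, hm, hr, hr', heq⟩ := exists_discMinusDisc_eq_hyperbolicAnnulus hc hlt
    rw [heq]
    exact isConnected_hyperbolicAnnulus hm hr.le hr'
  · rw [← crescentQ_eq_discMinusDisc]
    exact isConnected_crescentQ

theorem closure_discMinusDisc_subset (c : ℝ) :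
    closure (discMinusDisc c) ⊆ {z | ‖z‖ ≤ 1 ∧ 1 / 2 ≤ ‖z - c‖} := by
  refine closure_minimal (fun z hz => ⟨(mem_ball_zero_iff.1 hz.1).le, hz.2.le⟩) ?_
  exact (isClosed_le continuous_norm continuous_const).inter
    (isClosed_le continuous_const (by fun_prop : Continuous fun z : ℂ => ‖z - c‖))

theorem isRegularBase_discMinusDisc {c : ℝ} (hc : 0 ≤ c) (hc' : c ≤ 1 / 2) :
    IsRegularBase (discMinusDisc c) where
  isOpen := isOpen_discMinusDisc c
  isConnected := isConnected_discMinusDisc hc hc'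
  subset_ball _ hz := hz.1
  exists_notMem := by
    refine ⟨c, ?_, fun h => ?_⟩
    · rw [mem_ball_zero_iff, Complex.norm_real, Real.norm_of_nonneg hc]
      linarith
    · have h1 := h.2
      rw [sub_self, norm_zero] at h1
      norm_num at h1
  interior_closure_subset := by
    have hset : {z : ℂ | ‖z‖ ≤ 1 ∧ 1 / 2 ≤ ‖z - c‖} =
        Metric.closedBall 0 1 ∩ (Metric.ball (c : ℂ) (1 / 2))ᶜ := by
      ext z
      simp [dist_eq_norm]
    refine (interior_mono (closure_discMinusDisc_subset c)).trans ?_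
    rw [hset, interior_inter, interior_closedBall _ one_ne_zero, interior_compl,
      closure_ball _ (by norm_num)]
    rintro z ⟨h1, h2⟩
    refine ⟨h1, ?_⟩
    rwa [mem_compl_iff, Metric.mem_closedBall, not_le, dist_eq_norm] at h2

/-! ### The domains are bounded and pseudoconvex -/

theorem continuous_apply_Cn {n : ℕ} (i : Fin n) : Continuous fun p : Cn n => p i := by fun_prop

/-- The fibre of `overBase Q` over `z` is the image of the punctured disc under the Möbius
transformation taking `0` to `z`; hence `overBase Q` is connected if `Q` is. -/
theorem IsRegularBase.isBoundedDomain_overBase {Q : Set ℂ} (hQ : IsRegularBase Q) :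
    IsBoundedDomain (overBase Q) where
  isOpen := (hQ.isOpen.preimage (continuous_apply_Cn 0)).inter
    ((Metric.isOpen_ball.preimage (continuous_apply_Cn 1)).inter
      (isOpen_ne_fun (continuous_apply_Cn 1) (continuous_apply_Cn 0)))
  isConnected := by
    have hneg : ∀ z ∈ Q, ‖-z‖ < 1 := fun z hz => by
      rw [norm_neg]
      exact mem_ball_zero_iff.1 (hQ.subset_ball hz)
    have himage : overBase Q = (fun p : ℂ × ℂ => (!₂[p.1, mobius (-p.1) p.2] : Cn 2)) ''
        (Q ×ˢ {z | z ∈ Metric.ball (0 : ℂ) 1 ∧ 0 < ‖z‖}) := by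
      ext p
      constructor
      · rintro ⟨h0, h1, hne⟩
        have k := isDiscAutPreserving_mobius (mem_ball_zero_iff.1 (hQ.subset_ball h0))
        refine ⟨(p 0, mobius (p 0) (p 1)), ⟨h0, k.mapsTo h1, ?_⟩, ?_⟩
        · refine norm_pos_iff.2 fun hzero => hne ?_
          change mobius (p 0) (p 1) = 0 at hzero
          have h2 := k.leftInv h1
          rw [hzero, mobius_neg_zero] at h2
          exact h2.symm
        · ext i
          fin_cases i
          · rfl
          · exact k.leftInv h1
      · rintro ⟨⟨z, ξ⟩, ⟨hz, hξ, hξ0⟩, rfl⟩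
        have k := isDiscAutPreserving_mobius (mem_ball_zero_iff.1 (hQ.subset_ball hz))
        refine ⟨hz, k.mapsTo_inv hξ, fun heq => ?_⟩
        have h1 : mobius (-z) ξ = z := heq
        have h2 := k.rightInv hξ
        rw [h1, mobius_self] at h2
        rw [← h2, norm_zero] at hξ0
        exact lt_irrefl _ hξ0
    rw [himage]
    refine (hQ.isConnected.prod (isConnected_annulus le_rfl one_pos)).image _ ?_
    refine (PiLp.continuous_toLp 2 _).comp_continuousOn (continuousOn_pi.2 fun i => ?_)
    fin_cases i
    · exact continuousOn_fst
    · refine ContinuousOn.div (f := fun p : ℂ × ℂ => p.2 - -p.1)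
        (g := fun p : ℂ × ℂ => 1 - starRingEnd ℂ (-p.1) * p.2) (by fun_prop) ?_ ?_
      · have hconj : Continuous fun p : ℂ × ℂ => starRingEnd ℂ (-p.1) :=
          Complex.continuous_conj.comp (continuous_fst.neg)
        exact (continuous_const.sub (hconj.mul continuous_snd)).continuousOn
      · exact fun p hp =>
          one_sub_conj_mul_ne_zero (hneg _ hp.1) (mem_ball_zero_iff.1 hp.2.1).le
  isBounded := by
    refine isBounded_iff_forall_norm_le.2 ⟨2, fun p hp => ?_⟩
    have h0 := mem_ball_zero_iff.1 (hQ.subset_ball hp.1)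
    have h1 := mem_ball_zero_iff.1 hp.2.1
    rw [EuclideanSpace.norm_eq, Fin.sum_univ_two]
    refine Real.sqrt_le_iff.2 ⟨by norm_num, ?_⟩
    nlinarith [norm_nonneg (p 0), norm_nonneg (p 1)]

/-- A continuous function which is, at every point, the greatest of the moduli of the holomorphic
functions that it dominates is plurisubharmonic, by the mean value property. -/
theorem isContinuousPSH_of_norm_le {n : ℕ} {D : Set (Cn n)} {u : Cn n → ℝ} (hu : ContinuousOn u D)
    (h : ∀ a ∈ D, ∃ f : Cn n → ℂ, DifferentiableOn ℂ f D ∧ ‖f a‖ = u a ∧ ∀ p ∈ D, ‖f p‖ ≤ u p) :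
    IsContinuousPSH D u where
  continuousOn := hu
  submean a b hab := by
    have ha : a ∈ D := by simpa using hab 0 (by simp)
    obtain ⟨f, hf, hfa, hfu⟩ := h a ha
    have hmaps : MapsTo (fun ζ : ℂ => a + ζ • b) (Metric.closedBall 0 1) D := fun ζ hζ =>
      hab ζ (mem_closedBall_zero_iff.1 hζ)
    have hsphere : Metric.sphere (0 : ℂ) |1| ⊆ Metric.closedBall 0 1 := by
      rw [abs_one]
      exact Metric.sphere_subset_closedBall
    have hline : Differentiable ℂ fun ζ : ℂ => a + ζ • b := by fun_prop
    have hF : DifferentiableOn ℂ (fun ζ : ℂ => f (a + ζ • b)) (Metric.closedBall 0 1) :=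
      hf.comp hline.differentiableOn hmaps
    have hmean : Real.circleAverage (fun ζ : ℂ => f (a + ζ • b)) 0 1 = f a := by
      have hdiff : DiffContOnCl ℂ (fun ζ : ℂ => f (a + ζ • b)) (Metric.ball 0 |1|) := by
        apply DifferentiableOn.diffContOnCl
        rw [abs_one, closure_ball _ one_ne_zero]
        exact hF
      simpa using hdiff.circleAverage
    have hle : ‖Real.circleAverage (fun ζ : ℂ => f (a + ζ • b)) 0 1‖ ≤
        Real.circleAverage (fun ζ : ℂ => ‖f (a + ζ • b)‖) 0 1 := by
      rw [Real.circleAverage_def, Real.circleAverage_def, norm_smul, smul_eq_mul,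
        Real.norm_of_nonneg (by positivity)]
      exact mul_le_mul_of_nonneg_left
        (intervalIntegral.norm_integral_le_integral_norm (by positivity)) (by positivity)
    rw [hmean, hfa] at hle
    refine hle.trans (Real.circleAverage_mono ?_ ?_ fun ζ hζ => hfu _ (hmaps (hsphere hζ)))
    · exact ContinuousOn.circleIntegrable' (hF.continuousOn.norm.mono hsphere)
    · exact ContinuousOn.circleIntegrable'
        ((hu.comp hline.continuous.continuousOn hmaps).mono hsphere)

/-- A bounded open set `{0 < δ}` is pseudoconvex if, for each of its points, the function `δ` is
dominated by the modulus of a holomorphic function with equality at that point: then `1 / δ` is a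
plurisubharmonic exhaustion function. -/
theorem isPseudoconvex_of_le_norm {n : ℕ} {D : Set (Cn n)} {δ : Cn n → ℝ} (hδ : Continuous δ)
    (hD : ∀ p, p ∈ D ↔ 0 < δ p) (hD' : Bornology.IsBounded D)
    (h : ∀ a ∈ D, ∃ f : Cn n → ℂ, Differentiable ℂ f ∧ ‖f a‖ = δ a ∧ ∀ p ∈ D, δ p ≤ ‖f p‖) :
    IsPseudoconvex D := by
  have hset : D = {p | 0 < δ p} := Set.ext hD
  refine ⟨hset ▸ isOpen_lt continuous_const hδ, fun p => (δ p)⁻¹, ?_, fun c => ?_⟩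
  · refine isContinuousPSH_of_norm_le
      (hδ.continuousOn.inv₀ fun p hp => ((hD p).1 hp).ne') fun a ha => ?_
    obtain ⟨f, hf, hfa, hle⟩ := h a ha
    have hne : ∀ p ∈ D, f p ≠ 0 := fun p hp =>
      norm_pos_iff.1 (((hD p).1 hp).trans_le (hle p hp))
    refine ⟨fun p => (f p)⁻¹, hf.differentiableOn.inv hne, by rw [norm_inv, hfa], fun p hp => ?_⟩
    rw [norm_inv]
    exact inv_anti₀ ((hD p).1 hp) (hle p hp)
  · rcases le_or_gt c 0 with hc | hc
    · convert isCompact_empty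
      rw [eq_empty_iff_forall_notMem]
      rintro p ⟨hp, hpc⟩
      exact absurd (hpc.trans hc) (not_le.2 (inv_pos.2 ((hD p).1 hp)))
    · have heq : {p | p ∈ D ∧ (δ p)⁻¹ ≤ c} = {p | c⁻¹ ≤ δ p} := by
        ext p
        constructor
        · rintro ⟨hp, hpc⟩
          exact (inv_le_comm₀ ((hD p).1 hp) hc).1 hpc
        · intro hp
          have hpos : 0 < δ p := (inv_pos.2 hc).trans_le hp
          exact ⟨(hD p).2 hpos, (inv_le_comm₀ hpos hc).2 hp⟩
      rw [heq]
      refine Metric.isCompact_of_isClosed_isBounded (isClosed_le continuous_const hδ)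
        (hD'.subset fun p hp => (hD p).2 ((inv_pos.2 hc).trans_le hp))

/-- The distance from a point of the unit disc to the unit circle is attained, and it is a lower bound
for the distance to every point of the circle. -/
theorem exists_norm_sub_eq_sub_norm {z : ℂ} (hz : ‖z‖ ≤ 1) :
    ∃ ξ : ℂ, ‖z - ξ‖ = 1 - ‖z‖ ∧ ∀ y : ℂ, 1 - ‖y‖ ≤ ‖y - ξ‖ := by
  have hnorm : ∀ {ξ : ℂ}, ‖ξ‖ = 1 → ∀ y : ℂ, 1 - ‖y‖ ≤ ‖y - ξ‖ := by
    intro ξ hξ y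
    rw [← hξ, norm_sub_rev]
    exact norm_sub_norm_le ξ y
  rcases eq_or_ne z 0 with rfl | hne
  · exact ⟨1, by simp, hnorm norm_one⟩
  · have hpos : 0 < ‖z‖ := norm_pos_iff.2 hne
    have hξ : ‖z / (‖z‖ : ℂ)‖ = 1 := by
      rw [norm_div, Complex.norm_real, norm_norm, div_self hpos.ne']
    refine ⟨z / ‖z‖, ?_, hnorm hξ⟩
    have e : z - z / ‖z‖ = ((‖z‖ - 1 : ℝ) : ℂ) * (z / ‖z‖) := by
      have : (‖z‖ : ℂ) ≠ 0 := Complex.ofReal_ne_zero.2 hpos.ne'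
      push_cast
      field_simp
    rw [e, norm_mul, hξ, mul_one, Complex.norm_real, Real.norm_eq_abs,
      abs_of_nonpos (by linarith)]
    ring

/-- The nearest point of the circle of centre `c` and radius `1/2`. -/
theorem exists_norm_sub_eq_abs_norm_sub {c z : ℂ} (hz : z ≠ c) :
    ∃ ξ : ℂ, ‖ξ - c‖ = 1 / 2 ∧ ‖z - ξ‖ = |‖z - c‖ - 1 / 2| := by
  have hpos : 0 < ‖z - c‖ := norm_pos_iff.2 (sub_ne_zero.2 hz)
  have hn : (‖z - c‖ : ℂ) ≠ 0 := Complex.ofReal_ne_zero.2 hpos.ne'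
  have hunit : ‖(z - c) / (‖z - c‖ : ℂ)‖ = 1 := by
    rw [norm_div, Complex.norm_real, norm_norm, div_self hpos.ne']
  refine ⟨c + 1 / 2 * ((z - c) / ‖z - c‖), ?_, ?_⟩
  · rw [add_sub_cancel_left, norm_mul, hunit]
    norm_num
  · have e : z - (c + 1 / 2 * ((z - c) / ‖z - c‖)) =
        ((‖z - c‖ - 1 / 2 : ℝ) : ℂ) * ((z - c) / ‖z - c‖) := by
      push_cast
      field_simp
      ring
    rw [e, norm_mul, hunit, mul_one, Complex.norm_real, Real.norm_eq_abs]

theorem isPseudoconvex_overBase_discMinusDisc {c : ℝ} (hc : 0 ≤ c) (hc' : c ≤ 1 / 2) :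
    IsPseudoconvex (overBase (discMinusDisc c)) := by
  let δ : Cn 2 → ℝ := fun p =>
    min (min (1 - ‖p 0‖) (1 - ‖p 1‖)) (min (‖p 0 - c‖ - 1 / 2) ‖p 1 - p 0‖)
  have hproj : ∀ i : Fin 2, Differentiable ℂ fun p : Cn 2 => p i := fun i =>
    differentiable_euclidean.1 differentiable_id i
  refine isPseudoconvex_of_le_norm (δ := δ) ?_ (fun p => ?_)
    (isRegularBase_discMinusDisc hc hc').isBoundedDomain_overBase.isBounded fun a ha => ?_
  · have h0 := continuous_apply_Cn (n := 2) 0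
    have h1 := continuous_apply_Cn (n := 2) 1
    exact ((continuous_const.sub h0.norm).min (continuous_const.sub h1.norm)).min
      (((h0.sub continuous_const).norm.sub continuous_const).min (h1.sub h0).norm)
  · simp only [δ, lt_min_iff, sub_pos, overBase, discMinusDisc, mem_ofPred_eq, mem_ball_zero_iff,
      norm_pos_iff, sub_ne_zero]
    tauto
  · have hle₁ : ∀ p, δ p ≤ 1 - ‖p 0‖ := fun p => (min_le_left _ _).trans (min_le_left _ _)
    have hle₂ : ∀ p, δ p ≤ 1 - ‖p 1‖ := fun p => (min_le_left _ _).trans (min_le_right _ _)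
    have hle₃ : ∀ p, δ p ≤ ‖p 0 - c‖ - 1 / 2 := fun p =>
      (min_le_right _ _).trans (min_le_left _ _)
    have hle₄ : ∀ p, δ p ≤ ‖p 1 - p 0‖ := fun p => (min_le_right _ _).trans (min_le_right _ _)
    -- The minimum is attained by one of the four functions.
    have hcases : (δ a = 1 - ‖a 0‖ ∨ δ a = 1 - ‖a 1‖) ∨
        (δ a = ‖a 0 - c‖ - 1 / 2 ∨ δ a = ‖a 1 - a 0‖) := by
      rcases min_choice (min (1 - ‖a 0‖) (1 - ‖a 1‖)) (min (‖a 0 - c‖ - 1 / 2) ‖a 1 - a 0‖)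
        with h | h
      · rcases min_choice (1 - ‖a 0‖) (1 - ‖a 1‖) with h' | h'
        · exact Or.inl (Or.inl (h.trans h'))
        · exact Or.inl (Or.inr (h.trans h'))
      · rcases min_choice (‖a 0 - c‖ - 1 / 2) ‖a 1 - a 0‖ with h' | h'
        · exact Or.inr (Or.inl (h.trans h'))
        · exact Or.inr (Or.inr (h.trans h'))
    rcases hcases with (h | h) | (h | h)
    · obtain ⟨ξ, h1, h2⟩ := exists_norm_sub_eq_sub_norm (mem_ball_zero_iff.1 ha.1.1).le
      exact ⟨fun p => p 0 - ξ, (hproj 0).sub_const ξ, by rw [h1, h],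
        fun p _ => (hle₁ p).trans (h2 _)⟩
    · obtain ⟨ξ, h1, h2⟩ := exists_norm_sub_eq_sub_norm (mem_ball_zero_iff.1 ha.2.1).le
      exact ⟨fun p => p 1 - ξ, (hproj 1).sub_const ξ, by rw [h1, h],
        fun p _ => (hle₂ p).trans (h2 _)⟩
    · have hhalf : 1 / 2 < ‖a 0 - c‖ := ha.1.2
      have hne : a 0 ≠ c := sub_ne_zero.1 (norm_pos_iff.1 (by linarith))
      obtain ⟨ξ, h1, h2⟩ := exists_norm_sub_eq_abs_norm_sub hne
      refine ⟨fun p => p 0 - ξ, (hproj 0).sub_const ξ, ?_, fun p _ => (hle₃ p).trans ?_⟩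
      · rw [h2, h, abs_of_pos (by linarith)]
      · have h3 := norm_add_le (p 0 - ξ) (ξ - c)
        rw [sub_add_sub_cancel, h1] at h3
        linarith
    · exact ⟨fun p => p 1 - p 0, (hproj 1).sub (hproj 0), h.symm, fun p _ => hle₄ p⟩

/-! ### Convergence of the boundaries -/

/-- The closed set `‖z‖ ≤ 1`, `1 / 2 ≤ ‖z - c‖` is contained in the closure of `discMinusDisc c`.
Points of the inner circle are moved away from `c`, and points of the unit circle towards `0`. For
`c = 1 / 2` the point of tangency `1` is a limit of other points of the unit circle. -/
theorem mem_closure_discMinusDisc {c : ℝ} (hc : 0 ≤ c) (hc' : c ≤ 1 / 2) {z : ℂ} (hz : ‖z‖ ≤ 1)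
    (hz' : 1 / 2 ≤ ‖z - c‖) : z ∈ closure (discMinusDisc c) := by
  have hright : (𝓝[>] (0 : ℝ)) ≤ 𝓝 0 := inf_le_left
  have houter : ∀ {y : ℂ}, ‖y‖ = 1 → 1 / 2 < ‖y - c‖ → y ∈ closure (discMinusDisc c) := by
    intro y hy hy'
    have hcont : Continuous fun t : ℝ => (1 - t : ℂ) * y := by fun_prop
    have ht : Tendsto (fun t : ℝ => (1 - t : ℂ) * y) (𝓝 0) (𝓝 y) := by
      have := hcont.tendsto 0
      rwa [Complex.ofReal_zero, sub_zero, one_mul] at this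
    have hopen : IsOpen {x : ℂ | 1 / 2 < ‖x - c‖} :=
      isOpen_lt continuous_const (by fun_prop : Continuous fun x : ℂ => ‖x - c‖)
    refine mem_closure_of_tendsto (ht.mono_left hright) ?_
    filter_upwards [hright (ht (hopen.mem_nhds hy')), self_mem_nhdsWithin,
      hright (gt_mem_nhds one_pos)] with t h1 h2 h3
    refine ⟨?_, h1⟩
    have e : (1 - t : ℂ) * y = ((1 - t : ℝ) : ℂ) * y := by push_cast; ring
    have h2' : 0 < t := h2
    rw [mem_ball_zero_iff, e, norm_mul, hy, mul_one, Complex.norm_real,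
      Real.norm_of_nonneg (by linarith)]
    linarith
  rcases hz.lt_or_eq with hlt | heq
  · have hcont : Continuous fun t : ℝ => z + t * (z - c) := by fun_prop
    have ht : Tendsto (fun t : ℝ => z + t * (z - c)) (𝓝 0) (𝓝 z) := by
      have := hcont.tendsto 0
      rwa [Complex.ofReal_zero, zero_mul, add_zero] at this
    refine mem_closure_of_tendsto (ht.mono_left hright) ?_
    filter_upwards [hright (ht (Metric.isOpen_ball.mem_nhds (mem_ball_zero_iff.2 hlt))),
      self_mem_nhdsWithin] with t h1 h2
    refine ⟨h1, ?_⟩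
    have h2' : 0 < t := h2
    have e : z + t * (z - c) - c = ((1 + t : ℝ) : ℂ) * (z - c) := by push_cast; ring
    rw [e, norm_mul, Complex.norm_real, Real.norm_of_nonneg (by linarith)]
    nlinarith
  · rcases hz'.lt_or_eq with hlt' | heq'
    · exact houter heq hlt'
    · -- The unit circle meets the inner circle only at `z = 1`, for `c = 1 / 2`.
      have h1 : z.re ^ 2 + z.im ^ 2 = 1 := by
        have := congrArg (· ^ 2) heq
        simp only [← Complex.normSq_eq_norm_sq, Complex.normSq_apply] at this
        linarith
      have h2 : (z.re - c) ^ 2 + z.im ^ 2 = 1 / 4 := by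
        have := congrArg (· ^ 2) heq'
        simp only [← Complex.normSq_eq_norm_sq, Complex.normSq_apply, Complex.sub_re,
          Complex.sub_im, Complex.ofReal_re, Complex.ofReal_im] at this
        linarith
      have hre : z.re ≤ 1 := by nlinarith [sq_nonneg z.im]
      have hc1 : c = 1 / 2 := by nlinarith
      have hre1 : z.re = 1 := by rw [hc1] at h2; linarith
      have him : z.im = 0 := by
        rw [hre1] at h1
        exact pow_eq_zero_iff two_ne_zero |>.1 (by linarith)
      have hz1 : z = 1 := Complex.ext hre1 him
      have hcont : Continuous fun θ : ℝ => Complex.exp (θ * Complex.I) := by fun_prop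
      have ht : Tendsto (fun θ : ℝ => Complex.exp (θ * Complex.I)) (𝓝 0) (𝓝 1) := by
        have := hcont.tendsto 0
        rwa [Complex.ofReal_zero, zero_mul, Complex.exp_zero] at this
      rw [← closure_closure, hz1]
      refine mem_closure_of_tendsto (ht.mono_left hright) ?_
      filter_upwards [self_mem_nhdsWithin, hright (gt_mem_nhds Real.pi_pos)] with θ h3 h4
      have h3' : 0 < θ := h3
      refine houter (Complex.norm_exp_ofReal_mul_I θ) ?_
      have hcos : Real.cos θ < 1 := by
        have := Real.cos_lt_cos_of_nonneg_of_le_pi le_rfl h4.le h3'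
        rwa [Real.cos_zero] at this
      rw [← sq_lt_sq₀ (by norm_num) (norm_nonneg _), ← Complex.normSq_eq_norm_sq,
        Complex.normSq_apply, Complex.sub_re, Complex.sub_im, Complex.exp_ofReal_mul_I_re,
        Complex.exp_ofReal_mul_I_im, Complex.ofReal_re, Complex.ofReal_im, hc1]
      nlinarith [Real.sin_sq_add_cos_sq θ]

/-- The boundary of `overBase Q`, for the base `Q = discMinusDisc c`, is the complement of
`overBase Q` in the product of the closure of `Q` and the closed unit disc. -/
theorem mem_frontier_overBase_iff {c : ℝ} (hc : 0 ≤ c) (hc' : c ≤ 1 / 2) {p : Cn 2} :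
    p ∈ frontier (overBase (discMinusDisc c)) ↔
      (‖p 0‖ ≤ 1 ∧ 1 / 2 ≤ ‖p 0 - c‖ ∧ ‖p 1‖ ≤ 1) ∧ p ∉ overBase (discMinusDisc c) := by
  have hQ := isRegularBase_discMinusDisc hc hc'
  rw [hQ.isBoundedDomain_overBase.isOpen.frontier_eq, Set.mem_sdiff]
  refine and_congr_left fun _ => ⟨fun h => ?_, fun ⟨h0, h0', h1⟩ => ?_⟩
  · have hcl : IsClosed {p : Cn 2 | ‖p 0‖ ≤ 1 ∧ 1 / 2 ≤ ‖p 0 - c‖ ∧ ‖p 1‖ ≤ 1} := by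
      have c0 := continuous_apply_Cn (n := 2) 0
      have c1 := continuous_apply_Cn (n := 2) 1
      exact (isClosed_le c0.norm continuous_const).inter
        ((isClosed_le continuous_const (c0.sub continuous_const).norm).inter
          (isClosed_le c1.norm continuous_const))
    exact closure_minimal (fun q hq => (⟨(mem_ball_zero_iff.1 hq.1.1).le, hq.1.2.le,
      (mem_ball_zero_iff.1 hq.2.1).le⟩ : _ ∧ _ ∧ _)) hcl h
  · have hfst : ∀ w : ℂ, Continuous fun z : ℂ => (!₂[z, w] : Cn 2) := fun w =>
      (PiLp.continuous_toLp 2 _).comp (continuous_pi fun i => by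
        fin_cases i
        · exact continuous_id
        · exact continuous_const)
    have hsnd : ∀ z : ℂ, Continuous fun w : ℂ => (!₂[z, w] : Cn 2) := fun z =>
      (PiLp.continuous_toLp 2 _).comp (continuous_pi fun i => by
        fin_cases i
        · exact continuous_const
        · exact continuous_id)
    have hp1 : ∀ z : ℂ, p 1 ∈ closure (Metric.ball (0 : ℂ) 1 ∩ {z}ᶜ) := by
      intro z
      have h2 := closure_minimal
        ((dense_compl_singleton z).open_subset_closure_inter (Metric.isOpen_ball (x := (0 : ℂ))
          (ε := 1))) isClosed_closure
      rw [closure_ball _ one_ne_zero] at h2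
      exact h2 (mem_closedBall_zero_iff.2 h1)
    have hstep : ∀ z ∈ discMinusDisc c,
        (!₂[z, p 1] : Cn 2) ∈ closure (overBase (discMinusDisc c)) := fun z hz =>
      map_mem_closure (f := fun w : ℂ => (!₂[z, w] : Cn 2)) (hsnd z) (hp1 z) fun w hw => ⟨hz, hw.1, hw.2⟩
    have h3 := map_mem_closure (f := fun z : ℂ => (!₂[z, p 1] : Cn 2)) (hfst (p 1))
      (mem_closure_discMinusDisc hc hc' h0 h0') hstep
    rw [closure_closure] at h3
    convert h3 using 1
    ext i
    fin_cases i <;> rfl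

/-- A point of the closure of `discMinusDisc c` lies at distance at most `|c - c'|` from a point of
the closure of `discMinusDisc c'`, and from a boundary point if it is itself a boundary point. The
point is kept, translated, or projected to the inner circle about `c'`. -/
theorem exists_near_closure_discMinusDisc {c c' : ℝ} (hc : 0 ≤ c) (hc' : c ≤ 1 / 2) (hd : 0 ≤ c')
    (hd' : c' ≤ 1 / 2) {z : ℂ} (hz : ‖z‖ ≤ 1) (hz' : 1 / 2 ≤ ‖z - c‖) :
    ∃ y : ℂ, ‖y‖ ≤ 1 ∧ 1 / 2 ≤ ‖y - c'‖ ∧ dist z y ≤ |c - c'| ∧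
      (z ∉ discMinusDisc c → y ∉ discMinusDisc c') := by
  have hball : ∀ {y : ℂ}, ‖y - c'‖ = 1 / 2 → ‖y‖ ≤ 1 := by
    intro y hy
    have h1 := norm_add_le (y - c') (c' : ℂ)
    rw [sub_add_cancel, hy, Complex.norm_real, Real.norm_of_nonneg hd] at h1
    linarith
  have hcdist : ‖(c : ℂ) - c'‖ = |c - c'| := by
    rw [← Complex.ofReal_sub, Complex.norm_real, Real.norm_eq_abs]
  have habs : |c - c'| ≤ 1 / 2 := abs_le.2 ⟨by linarith, by linarith⟩
  rcases hz.lt_or_eq with hlt | heq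
  · rcases hz'.lt_or_eq with hlt' | heq'
    · have hmem : z ∈ discMinusDisc c := ⟨mem_ball_zero_iff.2 hlt, hlt'⟩
      rcases le_or_gt (1 / 2) ‖z - c'‖ with h | h
      · exact ⟨z, hz, h, by rw [dist_self]; exact abs_nonneg _, fun hn => absurd hmem hn⟩
      · have hne : z ≠ c' := by
          rintro rfl
          rw [norm_sub_rev, hcdist] at hlt'
          linarith
        obtain ⟨ξ, h1, h2⟩ := exists_norm_sub_eq_abs_norm_sub hne
        refine ⟨ξ, hball h1, h1.ge, ?_, fun hn => absurd hmem hn⟩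
        rw [dist_eq_norm, h2, abs_of_neg (by linarith), ← hcdist]
        have h3 := norm_sub_le (z - c') ((c : ℂ) - c')
        rw [sub_sub_sub_cancel_right] at h3
        linarith
    · have h1 : ‖z + (c' - c) - c'‖ = 1 / 2 := by
        rw [heq']
        congr 1
        ring
      refine ⟨z + (c' - c), hball h1, h1.ge, ?_, fun _ hy => hy.2.ne' h1⟩
      rw [dist_eq_norm, ← hcdist]
      exact le_of_eq (congrArg norm (by ring))
  · refine ⟨z, hz, ?_, by rw [dist_self]; exact abs_nonneg _, fun _ hy =>
      (mem_ball_zero_iff.1 hy.1).ne heq⟩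
    have h1 := norm_sub_norm_le z (c' : ℂ)
    rw [heq, Complex.norm_real, Real.norm_of_nonneg hd] at h1
    linarith

theorem dist_le_add_dist_apply (p q : Cn 2) : dist p q ≤ dist (p 0) (q 0) + dist (p 1) (q 1) := by
  rw [EuclideanSpace.dist_eq, Fin.sum_univ_two]
  refine Real.sqrt_le_iff.2 ⟨by positivity, ?_⟩
  nlinarith [mul_nonneg (dist_nonneg (x := p 0) (y := q 0)) (dist_nonneg (x := p 1) (y := q 1))]

/-- The factor `2` accounts for the points of the diagonal, both of whose coordinates move. -/
theorem exists_near_frontier_overBase {c c' : ℝ} (hc : 0 ≤ c) (hc' : c ≤ 1 / 2) (hd : 0 ≤ c')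
    (hd' : c' ≤ 1 / 2) {p : Cn 2} (hp : p ∈ frontier (overBase (discMinusDisc c))) :
    ∃ q ∈ frontier (overBase (discMinusDisc c')), dist p q ≤ 2 * |c - c'| := by
  obtain ⟨⟨h0, h0', h1⟩, hnot⟩ := (mem_frontier_overBase_iff hc hc').1 hp
  obtain ⟨y, hy, hy', hdist, hfr⟩ := exists_near_closure_discMinusDisc hc hc' hd hd' h0 h0'
  by_cases hdiag : p 1 = p 0
  · refine ⟨!₂[y, y], (mem_frontier_overBase_iff hd hd').2 ⟨⟨hy, hy', hy⟩, fun h => h.2.2 rfl⟩, ?_⟩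
    refine (dist_le_add_dist_apply _ _).trans ?_
    change dist (p 0) y + dist (p 1) y ≤ _
    rw [hdiag]
    linarith
  · refine ⟨!₂[y, p 1], (mem_frontier_overBase_iff hd hd').2 ⟨⟨hy, hy', h1⟩, fun h => ?_⟩, ?_⟩
    · exact hnot ⟨by_contra fun hn => hfr hn h.1, h.2.1, hdiag⟩
    · refine (dist_le_add_dist_apply _ _).trans ?_
      change dist (p 0) y + dist (p 1) (p 1) ≤ _
      rw [dist_self]
      linarith [abs_nonneg (c - c')]

theorem hausdorffEDist_frontier_overBase_le {c c' : ℝ} (hc : 0 ≤ c) (hc' : c ≤ 1 / 2) (hd : 0 ≤ c')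
    (hd' : c' ≤ 1 / 2) :
    Metric.hausdorffEDist (frontier (overBase (discMinusDisc c)))
      (frontier (overBase (discMinusDisc c'))) ≤ ENNReal.ofReal (2 * |c - c'|) := by
  refine Metric.hausdorffEDist_le_of_mem_edist (fun p hp => ?_) fun p hp => ?_
  · obtain ⟨q, hq, hpq⟩ := exists_near_frontier_overBase hc hc' hd hd' hp
    exact ⟨q, hq, by rw [edist_dist]; exact ENNReal.ofReal_le_ofReal hpq⟩
  · obtain ⟨q, hq, hpq⟩ := exists_near_frontier_overBase hd hd' hc hc' hp
    rw [abs_sub_comm] at hpq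
    exact ⟨q, hq, by rw [edist_dist]; exact ENNReal.ofReal_le_ofReal hpq⟩

theorem convergesInH_overBase_annulusQ :
    ConvergesInH (fun j => overBase (annulusQ j)) (overBase crescentQ) := by
  have hpow : Tendsto (fun j : ℕ => (1 / 2 : ℝ) ^ j) atTop (𝓝 0) :=
    tendsto_pow_atTop_nhds_zero_of_lt_one (by norm_num) (by norm_num)
  have hbound : Tendsto (fun j : ℕ => ENNReal.ofReal (2 * (1 / 2 : ℝ) ^ j)) atTop (𝓝 0) := by
    have := ENNReal.tendsto_ofReal (hpow.const_mul 2)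
    rwa [mul_zero, ENNReal.ofReal_zero] at this
  refine tendsto_of_tendsto_of_tendsto_of_le_of_le' tendsto_const_nhds hbound
    (Eventually.of_forall fun _ => bot_le) ?_
  filter_upwards [eventually_ge_atTop 1] with j hj
  have h1 : (1 / 2 : ℝ) ^ j ≤ 1 / 2 := pow_le_of_le_one (by norm_num) (by norm_num) (by omega)
  have h2 : 0 < (1 / 2 : ℝ) ^ j := by positivity
  have h3 := hausdorffEDist_frontier_overBase_le (c := 1 / 2 - (1 / 2) ^ j) (c' := 1 / 2)
    (by linarith) (by linarith) (by norm_num) le_rfl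
  rw [sub_sub_cancel_left, abs_neg, abs_of_pos h2] at h3
  rw [annulusQ_eq_discMinusDisc, crescentQ_eq_discMinusDisc]
  exact h3

/-! ### The sequence of domains and its limit -/

theorem mainTheorem5 :
    (∀ j : ℕ, 1 ≤ j →
      IsBoundedDomain (overBase (annulusQ j)) ∧
      IsPseudoconvex (overBase (annulusQ j)) ∧
      Nonempty (HolAut (overBase (annulusQ j)) ≃ₜ* Circle) ∧
      ∀ K : Subgroup (HolAut (overBase (annulusQ j))),
        IsMaximalCompactSubgroup K ↔ K = ⊤) ∧
    IsBoundedDomain (overBase crescentQ) ∧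
    IsPseudoconvex (overBase crescentQ) ∧
    ConvergesInH (fun j => overBase (annulusQ j)) (overBase crescentQ) ∧
    Nonempty (HolAut (overBase crescentQ) ≃ₜ* Multiplicative ℝ) ∧
    (∀ K : Subgroup (HolAut (overBase crescentQ)),
      IsMaximalCompactSubgroup K ↔ K = ⊥) := by
  have hcrescent : IsRegularBase crescentQ := by
    rw [crescentQ_eq_discMinusDisc]
    exact isRegularBase_discMinusDisc (by norm_num) le_rfl
  obtain ⟨e⟩ := nonempty_holAut_crescentQ hcrescent
  refine ⟨fun j hj => ?_, hcrescent.isBoundedDomain_overBase, ?_, convergesInH_overBase_annulusQ,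
    ⟨e⟩, isMaximalCompactSubgroup_iff_eq_bot e⟩
  · have h1 : (1 / 2 : ℝ) ^ j ≤ 1 / 2 := pow_le_of_le_one (by norm_num) (by norm_num) (by omega)
    have h2 : 0 < (1 / 2 : ℝ) ^ j := by positivity
    have h0 : (0 : ℝ) ≤ 1 / 2 - (1 / 2) ^ j := by linarith
    have hlt : 1 / 2 - (1 / 2 : ℝ) ^ j < 1 / 2 := by linarith
    have hQ := isRegularBase_discMinusDisc h0 hlt.le
    obtain ⟨m, r, hm, hr, hr', heq⟩ := exists_discMinusDisc_eq_hyperbolicAnnulus h0 hlt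
    rw [annulusQ_eq_discMinusDisc]
    obtain ⟨e⟩ : Nonempty (HolAut (overBase (discMinusDisc (1 / 2 - (1 / 2) ^ j))) ≃ₜ* Circle) := by
      rw [heq] at hQ ⊢
      exact nonempty_holAut_hyperbolicAnnulus hm hr hr' hQ
    have : CompactSpace (HolAut (overBase (discMinusDisc (1 / 2 - (1 / 2) ^ j)))) :=
      e.toHomeomorph.symm.compactSpace
    exact ⟨hQ.isBoundedDomain_overBase, isPseudoconvex_overBase_discMinusDisc h0 hlt.le, ⟨e⟩,
      isMaximalCompactSubgroup_iff_eq_top⟩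
  · rw [crescentQ_eq_discMinusDisc]
    exact isPseudoconvex_overBase_discMinusDisc (by norm_num) le_rfl
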